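/- Let $G$ be a finite group. For $H\le G$ put $\widehat H=\frac1{|H|}\sum_{h\in H}h\in\mathbb QG$, and for $\alpha\in\mathbb QG$, $g\in G$ put $\alpha^g=g^{-1}\alpha g$. For $K\unlhd H\le G$ let $\varepsilon(H,K)=\widehat K\prod_{M/K}(1-\widehat M)$, where $M/K$ runs over the minimal nontrivial normal subgroups of $H/K$ (so $\varepsilon(H,H)=\widehat H$), and let $e(G,H,K)$ be the sum of the distinct $G$-conjugates of $\varepsilon(H,K)$. A pair $(H,K)$ of subgroups of $G$ is a strong Shoda pair if $K\le H\unlhd N_G(K)$, $H/K$ is cyclic and a maximal abelian subgroup of $N_G(K)/K$, and $\varepsilon(H,K)\,\varepsilon(H,K)^g=0$ for all $g\in G\setminus N_G(K)$. The group $G$ is strongly monomial if every irreducible complex character of $G$ is induced from a linear character of $H$ with kernel $K$ for some strong Shoda pair $(H,K)$ of $G$. A set $X$ of strong Shoda pairs of $G$ is a complete set of representatives if $e(G,H_1,K_1)\ne e(G,H_2,K_2)$ for distinct $(H_1,K_1),(H_2,K_2)\in X$ and $\sum_{(H,K)\in X}e(G,H,K)=1$. Let $F$ be a number field. For $k\ge1$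 let $\zeta_k$ be a primitive $k$-th root of unity and let $I_k(F)\le(\mathbb Z/k\mathbb Z)^\times$ be the image of $\mathrm{Gal}(F(\zeta_k)/F)$ under $\sigma\mapsto t$, where $\sigma(\zeta_k)=\zeta_k^t$. For $K\unlhd H\le G$ with $H/K$ cyclic of order $k$, let $\mathcal C_F(H/K)$ be the set of orbits $\{\chi^i\mid i\in I_k(F)\}$ of the linear characters $\chi$ of $H$ with kernel $K$. The group $N_G(H)\cap N_G(K)$ acts on $\mathcal C_F(H/K)$ through $\chi^g(g^{-1}hg)=\chi(h)$; the stabilizer of $C\in\mathcal C_F(H/K)$ does not depend on $C$ and is denoted $E_F(G,H/K)$. If $(H,K)$ is a strong Shoda pair with $[H:K]=k$, the group $N_G(K)/H$ acts on $\mathbb Q(\zeta_k)$: if $g^{-1}hgK=h^iK$ for all $h\in H$, then $gH$ acts by $\zeta_k\mapsto\zeta_k^i$; write $\mathbb Q(\zeta_k)^{N_G(K)/H}$ for the fixed field. Let $\phi$ be Euler's function. **Proposition.** Let $G$ be a finite strongly monomial group, $F$ a number field, and $X$ a complete set of representatives of strong Shoda pairs of $G$. Then the number of simple components (that is, of minimal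 nonzero two-sided ideals) of the group algebra $FG$ equals $$\sum_{(H,K)\in X}\frac{\phi([H:K])}{|I_{[H:K]}(F)|}\,\frac{|E_F(G,H/K)|}{|N_G(K)|}=\sum_{(H,K)\in X}\bigl[\mathbb Q(\zeta_{[H:K]})^{N_G(K)/H}\cap F:\mathbb Q\bigr],$$ where the intersections are taken inside $F(\zeta_{[H:K]})$. -/

import Mathlib

open scoped Classical

namespace StrongShoda

noncomputable section

/-! ### Simple components -/

/-- The number of simple components of a (semisimple) ring `R`: the simple components are the
minimal nonzero two-sided ideals of `R`. -/
def numSimpleComponents (R : Type*) [Ring R] : ℕ :=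
  Nat.card {I : TwoSidedIdeal R // IsAtom I}

/-! ### Elements of the rational group algebra -/

section GroupAlgebra

variable {G : Type*} [Group G] [Fintype G]

/-- `Ĥ = |H|⁻¹ ∑_{h ∈ H} h` in `ℚG`. -/
def hat (H : Subgroup G) : MonoidAlgebra ℚ G :=
  (Nat.card H : ℚ)⁻¹ • ∑ h : G with h ∈ H, MonoidAlgebra.single h (1 : ℚ)

/-- `α ^ g = g⁻¹ α g` for `α ∈ ℚG`. -/
def conj (α : MonoidAlgebra ℚ G) (g : G) : MonoidAlgebra ℚ G :=
  MonoidAlgebra.single g⁻¹ (1 : ℚ) * α * MonoidAlgebra.single g (1 : ℚ)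

/-- `M / K` is a minimal nontrivial normal subgroup of `H / K`: `M` is minimal among the normal
subgroups of `H` that properly contain `K`. -/
def IsMinimalNormalOver (H K M : Subgroup G) : Prop :=
  Minimal (fun M : Subgroup G => K < M ∧ M ≤ H ∧ (M.subgroupOf H).Normal) M

theorem IsMinimalNormalOver.le_normalizer {H K M : Subgroup G} (h : IsMinimalNormalOver H K M) :
    H ≤ Subgroup.normalizer (M : Set G) :=
  (Subgroup.normal_subgroupOf_iff_le_normalizer h.prop.2.1).1 h.prop.2.2

theorem commute_single_hat {M : Subgroup G} {g : G} (hg : g ∈ Subgroup.normalizer (M : Set G)) :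
    Commute (MonoidAlgebra.single g (1 : ℚ)) (hat M) := by
  unfold hat
  refine Commute.smul_right ?_ _
  rw [commute_iff_eq, Finset.mul_sum, Finset.sum_mul]
  rw [Subgroup.mem_normalizer_iff] at hg
  refine Finset.sum_bij' (fun h _ => g * h * g⁻¹) (fun h _ => g⁻¹ * h * g) ?_ ?_ ?_ ?_ ?_
  · intro a ha
    simpa using (hg a).1 (by simpa using ha)
  · intro a ha
    simpa [mul_assoc] using (hg (g⁻¹ * a * g)).2 (by simpa [mul_assoc] using ha)
  · intro a _; group
  · intro a _; group
  · intro a _; simp [MonoidAlgebra.single_mul_single, mul_assoc]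

theorem commute_hat {H K M M' : Subgroup G} (h : IsMinimalNormalOver H K M)
    (h' : IsMinimalNormalOver H K M') : Commute (hat M) (hat M') := by
  rw [hat]
  refine Commute.smul_left (Commute.sum_left _ _ _ fun g hg => commute_single_hat ?_) _
  exact h'.le_normalizer (h.prop.2.1 (by simpa using hg))

/-- `ε(H, K) = K̂ ∏_{M/K} (1 - M̂)`, the product running over the minimal nontrivial normal
subgroups `M / K` of `H / K` (its factors commute); for `K = H` the product is empty and
`ε(H, H) = Ĥ`. -/
def eps (H K : Subgroup G) : MonoidAlgebra ℚ G :=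
  hat K * (Finset.univ.filter fun M : Subgroup G => IsMinimalNormalOver H K M).noncommProd
    (fun M => 1 - hat M) (by
      intro M hM M' hM' _
      have h : IsMinimalNormalOver H K M := by simpa using hM
      have h' : IsMinimalNormalOver H K M' := by simpa using hM'
      exact (Commute.one_left _).sub_left
        ((Commute.one_right _).sub_right (commute_hat h h')))

/-- `e(G, H, K)`: the sum of the different `G`-conjugates of `ε(H, K)`. -/
def idem (H K : Subgroup G) : MonoidAlgebra ℚ G :=
  ∑ α ∈ Finset.univ.image (fun g : G => conj (eps H K) g), α

/-! ### Strong Shoda pairs and strongly monomial groups -/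

/-- The subgroup `H / K` of `N_G(K) / K`. -/
def quotientInNormalizer (H K : Subgroup G) :
    Subgroup (Subgroup.normalizer (K : Set G) ⧸ K.subgroupOf (Subgroup.normalizer (K : Set G))) :=
  (H.subgroupOf (Subgroup.normalizer (K : Set G))).map
    (QuotientGroup.mk' (K.subgroupOf (Subgroup.normalizer (K : Set G))))

/-- `(H, K)` is a strong Shoda pair of `G`. -/
structure IsStrongShodaPair (H K : Subgroup G) : Prop where
  le : K ≤ H
  le_normalizer : H ≤ Subgroup.normalizer (K : Set G)
  normal : (H.subgroupOf (Subgroup.normalizer (K : Set G))).Normal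
  cyclic : IsCyclic (quotientInNormalizer H K)
  maximal : Maximal (fun A : Subgroup (Subgroup.normalizer (K : Set G) ⧸
    K.subgroupOf (Subgroup.normalizer (K : Set G))) => IsMulCommutative A)
    (quotientInNormalizer H K)
  ortho : ∀ g : G, g ∉ Subgroup.normalizer (K : Set G) → eps H K * conj (eps H K) g = 0

/-- The value at `g` of the character of `G` induced from the linear character `ψ` of `H`:
`|H|⁻¹ ∑_{x ∈ G} ψ°(x g x⁻¹)`, where `ψ°` extends `ψ` by zero. -/
def inducedCharacter {H : Subgroup G} (ψ : H →* ℂˣ) (g : G) : ℂ :=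
  (Nat.card H : ℂ)⁻¹ * ∑ x : G, if hx : x * g * x⁻¹ ∈ H then (ψ ⟨x * g * x⁻¹, hx⟩ : ℂ) else 0

/-- `G` is strongly monomial: every irreducible complex character of `G` is induced from a linear
character `ψ` of `H` with kernel `K`, for some strong Shoda pair `(H, K)` of `G`. -/
def IsStronglyMonomial (G : Type*) [Group G] [Fintype G] : Prop :=
  ∀ (V : Type) [AddCommGroup V] [Module ℂ V] [FiniteDimensional ℂ V] (ρ : Representation ℂ G V),
    ρ.IsIrreducible → ∃ (H K : Subgroup G) (ψ : H →* ℂˣ), IsStrongShodaPair H K ∧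
      ψ.ker = K.subgroupOf H ∧ ∀ g : G, ρ.character g = inducedCharacter ψ g

/-- `X` is a complete set of representatives of strong Shoda pairs of `G`, two strong Shoda pairs
being equivalent when they have the same `e(G, H, K)`. -/
structure IsCompleteSetOfRepresentatives (X : Finset (Subgroup G × Subgroup G)) : Prop where
  isStrongShodaPair : ∀ p ∈ X, IsStrongShodaPair p.1 p.2
  eq_of_idem_eq : ∀ p ∈ X, ∀ q ∈ X, idem p.1 p.2 = idem q.1 q.2 → p = q
  sum_idem : ∑ p ∈ X, idem p.1 p.2 = 1

end GroupAlgebra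

/-! ### Galois action on roots of unity -/

instance neZero_relIndex {G : Type*} [Group G] [Finite G] (H K : Subgroup G) :
    NeZero (K.relIndex H) :=
  ⟨Subgroup.index_ne_zero_of_finite⟩

/-- `I_k(F)`: the image of `Gal(F(ζ_k)/F)` in the units of `ℤ/kℤ`, an automorphism `σ` with
`σ(ζ_k) = ζ_k ^ t` being sent to `t`. -/
def galoisImage (F : Type*) [Field F] [CharZero F] (k : ℕ) [NeZero k] : Subgroup (ZMod k)ˣ :=
  (IsPrimitiveRoot.autToPow F
    (IsCyclotomicExtension.zeta_spec k F (CyclotomicField k F))).range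

section Action

variable {G : Type*} [Group G] [Finite G]

/-- `C_F(H/K)`: the set of orbits `{ψ ^ i | i ∈ I_k(F)}`, `k = [H : K]`, of the faithful linear
characters of `H / K`, regarded as linear characters of `H` with kernel `K`. -/
def charClasses (F : Type*) [Field F] [CharZero F] (H K : Subgroup G) : Set (Set (H →* ℂˣ)) :=
  {C | ∃ ψ : H →* ℂˣ, ψ.ker = K.subgroupOf H ∧
    C = {χ | ∃ i ∈ galoisImage F (K.relIndex H), χ = ψ ^ (i : ZMod (K.relIndex H)).val}}

/-- `C ^ g = {χ ^ g | χ ∈ C}` for `g ∈ N_G(H)`, where `χ ^ g` is the linear character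
`h ↦ χ (g h g⁻¹)` of `H`, that is `χ ^ g (g⁻¹ h g) = χ h`. -/
def conjClass {H : Subgroup G} (C : Set (H →* ℂˣ)) (g : Subgroup.normalizer (H : Set G)) :
    Set (H →* ℂˣ) :=
  (fun χ : H →* ℂˣ => χ.comp (H.normalizerMonoidHom g).toMonoidHom) '' C

/-- `E_F(G, H/K)`: the elements of `N_G(H) ∩ N_G(K)` that stabilize every
`C ∈ C_F(H/K)` (for `H / K` cyclic, all these `C` have the same stabilizer). -/
def stabE (F : Type*) [Field F] [CharZero F] (H K : Subgroup G) : Set G :=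
  {g | ∃ hg : g ∈ Subgroup.normalizer (H : Set G), g ∈ Subgroup.normalizer (K : Set G) ∧
    ∀ C ∈ charClasses F H K, conjClass C ⟨g, hg⟩ = C}

open IntermediateField in
/-- The group of automorphisms of `ℚ(ζ)` through which `N_G(K)` acts: if
`g⁻¹ h g ∈ h ^ i K` for all `h ∈ H`, then `g ∈ N_G(K)` acts by `ζ ↦ ζ ^ i`. -/
def actionGroup {L : Type*} [Field L] [CharZero L] (ζ : L) (H K : Subgroup G) :
    Subgroup Gal(ℚ⟮ζ⟯/ℚ) :=
  Subgroup.closure {σ | ∃ g ∈ Subgroup.normalizer (K : Set G), ∃ i : ℕ,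
    (∀ h ∈ H, (h ^ i)⁻¹ * (g⁻¹ * h * g) ∈ K) ∧
      σ (AdjoinSimple.gen ℚ ζ) = AdjoinSimple.gen ℚ ζ ^ i}

/-- The subfield `ℚ(ζ)^{N_G(K)/H}` of `L ∋ ζ`, the fixed field of the action of `N_G(K)/H`. -/
def fixedSubfield {L : Type*} [Field L] [CharZero L] (ζ : L) (H K : Subgroup G) :
    IntermediateField ℚ L :=
  IntermediateField.lift (IntermediateField.fixedField (actionGroup ζ H K))

/-- `[ℚ(ζ_k)^{N_G(K)/H} ∩ F : ℚ]` with `k = [H : K]`, the intersection being taken inside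
`F(ζ_k)`. -/
def interDegree (F : Type*) [Field F] [CharZero F] (H K : Subgroup G) : ℕ :=
  Module.finrank ℚ
    ↥(fixedSubfield (IsCyclotomicExtension.zeta (K.relIndex H) F
        (CyclotomicField (K.relIndex H) F)) H K ⊓
      (algebraMap F (CyclotomicField (K.relIndex H) F)).toRatAlgHom.fieldRange)

end Action

end

end StrongShoda

/-!
The group algebra `F[G]` is semisimple, so its minimal two-sided ideals correspond to the primes of
its centre `Z` (`numSimpleComponents_eq_card_primeSpectrum`), and it remains to count these primes.

Let `(H, K)` be a strong Shoda pair, `ε = ε(H, K)`, `e = e(G, H, K)` and `k = [H : K]`. For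
`z ∈ Z` the element `z ε` lies in `F[H]` (`center_mul_eps_mem`): orthogonality of the conjugates of
`ε` gives `ε F[G] ε ⊆ F[N_G(K)]`, and the cosets of `H` in `N_G(K)` other than `H` do not contribute
because `H / K` is its own centralizer in `N_G(K) / K`. Hence each linear character `ψ` of `H` with
kernel `K`, with values in `F(ζ_k)`, defines a homomorphism of algebras `ω_ψ : Z → F(ζ_k)`,
`z ↦ ψ(z ε)` (`centralCharacter`). It maps `e` to `1`, and an element of `Z` on which all `ω_ψ`
vanish is annihilated by `ε`, hence by `e` (`mul_eps_eq_zero`, Fourier inversion on `H / K`). As the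
idempotents `e(G, H, K)`, for `(H, K) ∈ X`, have sum `1`, the kernels of the `ω_ψ` are all the
primes of `Z`, and different pairs give different primes.

For a single pair, the characters `ψ` form a torsor under `(ℤ/kℤ)ˣ`. Two of them have the same `ω`
exactly if they are conjugate under `N_G(K)`, which acts on them through `conjExponent` (for one
direction, linear independence of characters is applied to the values of `ω_ψ` at the sums of the
conjugates of the `x ε`, `x ∈ H`), and two homomorphisms `Z → F(ζ_k)` have the same kernel exactly
if they differ by an element of `Gal(F(ζ_k)/F)`. So `ω_ψ` and `ω_{ψ ^ t}` have the same kernel if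
and only if `t ∈ A I` (`ker_centralCharacter_eq_iff`), where `A` is the image of `N_G(K)` in
`(ℤ/kℤ)ˣ` and `I = I_k(F)`. The number of simple components is therefore the sum over `X` of the
indices of the subgroups `A I` (`numSimpleComponents_eq_sum_index`).

Both expressions in the theorem are this index, pair by pair. The stabilizer `E_F(G, H/K)` is the
preimage of `I` in `N_G(K)`, so the first one is `[(ℤ/kℤ)ˣ : I] / [A : A ∩ I]`
(`totient_div_mul_eq_index`). In `Gal(ℚ(ζ_k)/ℚ) ≃ (ℤ/kℤ)ˣ`, the subfield `ℚ(ζ_k)^{N_G(K)/H}` is the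
fixed field of `A` and `ℚ(ζ_k) ∩ F` is the fixed field of `I`, so their intersection is the fixed
field of `A I`, and its degree is the index of `A I` (`finrank_fixedSubfield_inf`).
-/

namespace StrongShoda

noncomputable section

/-! ### Simple components and primes of the centre -/

section SimpleComponents
variable (F : Type*) [Field F] {R : Type*} [Ring R] [Algebra F R]

/-- The ideal of the centre that consists of the central elements annihilating a two-sided ideal `I`
of `R`; it is prime if `I` is minimal. -/
def centralAnnihilator (I : TwoSidedIdeal R) : Ideal (Subalgebra.center F R) where
  carrier := {z | ∀ x ∈ I, (z : R) * x = 0}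
  zero_mem' := fun x _ => by simp
  add_mem' := fun {a b} ha hb x hx => by simp [add_mul, ha x hx, hb x hx]
  smul_mem' := fun c z hz x hx => by simp [mul_assoc, hz x hx]

theorem isPrime_centralAnnihilator {I : TwoSidedIdeal R} (hI : IsAtom I) :
    (centralAnnihilator F I).IsPrime := by
  refine ⟨fun h => hI.1 ?_, fun {z w} hzw => ?_⟩
  · refine le_bot_iff.1 fun x hx => ?_
    have := (h ▸ Submodule.mem_top : (1 : Subalgebra.center F R) ∈ centralAnnihilator F I) x hx
    simpa using this
  · by_contra! hcon
    obtain ⟨hz, hw⟩ := hcon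
    have hzc := fun r : R => Subalgebra.mem_center_iff.1 z.2 r
    -- the part of `I` annihilated by `z` is a two-sided ideal, hence `⊥` or `I`
    let J : TwoSidedIdeal R := .mk' {x | x ∈ I ∧ (z : R) * x = 0} ⟨I.zero_mem, by simp⟩
      (fun {x y} hx hy => ⟨I.add_mem hx.1 hy.1, by rw [mul_add, hx.2, hy.2, add_zero]⟩)
      (fun {x} hx => ⟨I.neg_mem hx.1, by rw [mul_neg, hx.2, neg_zero]⟩)
      (fun {x y} hy => ⟨I.mul_mem_left _ _ hy.1, by
        rw [← mul_assoc, ← hzc x, mul_assoc, hy.2, mul_zero]⟩)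
      (fun {x y} hx => ⟨I.mul_mem_right _ _ hx.1, by rw [← mul_assoc, hx.2, zero_mul]⟩)
    have hJ : ∀ x, x ∈ J ↔ x ∈ I ∧ (z : R) * x = 0 := fun x => TwoSidedIdeal.mem_mk' ..
    have hJI : J ≤ I := fun x hx => ((hJ x).1 hx).1
    rcases hI.le_iff.1 hJI with h | h
    · refine hw fun x hx => ?_
      have : (w : R) * x ∈ J := (hJ _).2 ⟨I.mul_mem_left _ _ hx, by
        rw [← mul_assoc]; exact hzw x hx⟩
      rw [h] at this
      simpa using this
    · exact hz fun x hx => ((hJ x).1 (h ▸ hx)).2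

variable [IsSemisimpleRing R]

/-- The two-sided ideals of a semisimple ring correspond to the sets of isotypic components of the
regular module. -/
def twoSidedIdealEquivSet :
    TwoSidedIdeal R ≃o Set (isotypicComponents R R) :=
  (TwoSidedIdeal.orderIsoIsTwoSided.trans
    (show {I : Ideal R // I.IsTwoSided} ≃o fullyInvariantSubmodule R R from
      { toEquiv := Equiv.subtypeEquivRight fun _ => isFullyInvariant_iff_isTwoSided.symm
        map_rel_iff' := Iff.rfl })).trans OrderIso.setIsotypicComponents.symm

instance isAtomistic_twoSidedIdeal : IsAtomistic (TwoSidedIdeal R) := by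
  let e := twoSidedIdealEquivSet (R := R)
  refine CompleteLattice.isAtomistic_iff.2 fun I => ⟨e.symm '' {a | IsAtom a ∧ a ≤ e I}, ?_, ?_⟩
  · rw [sSup_image, ← e.symm.map_sSup, sSup_atoms_le_eq, e.symm_apply_apply]
  · rintro _ ⟨a, ha, rfl⟩
    exact (e.symm.isAtom_iff a).2 ha.1

instance complementedLattice_twoSidedIdeal : ComplementedLattice (TwoSidedIdeal R) :=
  (twoSidedIdealEquivSet (R := R)).complementedLattice_iff.2 inferInstance

/-- A two-sided ideal of a semisimple ring has a central identity element. -/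
theorem exists_central_identity (I : TwoSidedIdeal R) :
    ∃ e : Subalgebra.center F R, (e : R) ∈ I ∧ ∀ x ∈ I, (e : R) * x = x := by
  obtain ⟨C, hC⟩ := exists_isCompl I
  have hdisj : ∀ x, x ∈ I → x ∈ C → x = 0 := fun x h1 h2 => by
    have : x ∈ I ⊓ C := (TwoSidedIdeal.mem_inf R).2 ⟨h1, h2⟩
    rw [hC.inf_eq_bot] at this
    simpa using this
  obtain ⟨a, ha, b, hb, hab⟩ := TwoSidedIdeal.mem_sup.1
    (hC.sup_eq_top ▸ trivial : (1 : R) ∈ I ⊔ C)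
  refine ⟨⟨a, Subalgebra.mem_center_iff.2 fun r => sub_eq_zero.1 (hdisj _ ?_ ?_)⟩, ha,
    fun x hx => ?_⟩
  · exact I.sub_mem (I.mul_mem_left _ _ ha) (I.mul_mem_right _ _ ha)
  · have : r * a - a * r = b * r - r * b := by
      rw [eq_sub_of_add_eq hab]; noncomm_ring
    rw [this]
    exact C.sub_mem (C.mul_mem_right _ _ hb) (C.mul_mem_left _ _ hb)
  · have : b * x = 0 := hdisj _ (I.mul_mem_left _ _ hx) (C.mul_mem_right _ _ hb)
    calc a * x = (a + b) * x := by rw [add_mul, this, add_zero]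
      _ = x := by rw [hab, one_mul]

/-- The simple components of a semisimple ring correspond to the primes of its centre. -/
theorem numSimpleComponents_eq_card_primeSpectrum [Module.Finite F R] :
    numSimpleComponents R = Nat.card (PrimeSpectrum (Subalgebra.center F R)) := by
  have : IsArtinianRing (Subalgebra.center F R) := IsArtinianRing.of_finite F _
  let f : {I : TwoSidedIdeal R // IsAtom I} → PrimeSpectrum (Subalgebra.center F R) :=
    fun I => ⟨centralAnnihilator F I.1, isPrime_centralAnnihilator F I.2⟩
  have hinj : Function.Injective f := fun I J hIJ => by
    have hIJ' : centralAnnihilator F I.1 = centralAnnihilator F J.1 := congrArg (·.asIdeal) hIJ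
    by_contra hne
    -- if `I ≠ J`, the identity element of `I` annihilates `J` but not `I`
    obtain ⟨e, heI, he⟩ := exists_central_identity F I.1
    have hdisj : I.1 ⊓ J.1 = ⊥ := by
      rcases I.2.le_iff.1 (inf_le_left : I.1 ⊓ J.1 ≤ I.1) with h | h
      · exact h
      · refine absurd (Subtype.ext ?_) hne
        exact (J.2.le_iff.1 (inf_eq_left.1 h)).resolve_left I.2.1
    have h1 : e ∈ centralAnnihilator F J.1 := fun x hx => by
      have : (e : R) * x ∈ I.1 ⊓ J.1 := (TwoSidedIdeal.mem_inf R).2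
        ⟨I.1.mul_mem_right _ _ heI, J.1.mul_mem_left _ _ hx⟩
      rw [hdisj] at this
      simpa using this
    rw [← hIJ'] at h1
    exact I.2.1 (le_bot_iff.1 fun x hx => by simpa using (he x hx).symm.trans (h1 x hx))
  have : Finite {I : TwoSidedIdeal R // IsAtom I} := Finite.of_injective f hinj
  have := Fintype.ofFinite {I : TwoSidedIdeal R // IsAtom I}
  refine Nat.card_eq_of_bijective f ⟨hinj, fun P => ?_⟩
  -- the elements of the centre that annihilate all atoms vanish, as the atoms span `R`
  have hbot : (Finset.univ.inf fun I => (f I).asIdeal) ≤ P.asIdeal := by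
    intro z hz
    rw [Submodule.mem_finsetInf] at hz
    let A : TwoSidedIdeal R := .mk' {x | (z : R) * x = 0} (by simp)
      (fun {x y} hx hy => by
        simp only [Set.mem_ofPred_eq] at hx hy ⊢; rw [mul_add, hx, hy, add_zero])
      (fun {x} hx => by simp only [Set.mem_ofPred_eq] at hx ⊢; rw [mul_neg, hx, neg_zero])
      (fun {x y} hy => by
        simp only [Set.mem_ofPred_eq] at hy ⊢
        rw [← mul_assoc, ← Subalgebra.mem_center_iff.1 z.2 x, mul_assoc, hy, mul_zero])
      (fun {x y} hx => by simp only [Set.mem_ofPred_eq] at hx ⊢; rw [← mul_assoc, hx, zero_mul])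
    have hA : A = ⊤ := by
      refine top_le_iff.1 ((isLUB_atoms_top (α := TwoSidedIdeal R)).2 fun I hI x hx => ?_)
      exact (TwoSidedIdeal.mem_mk' ..).2 (hz ⟨I, hI⟩ (Finset.mem_univ _) x hx)
    have h1 : (1 : R) ∈ A := hA ▸ trivial
    have hAmem : ∀ x, x ∈ A ↔ (z : R) * x = 0 := fun x => TwoSidedIdeal.mem_mk' ..
    have hz0 : z = 0 := Subtype.ext (by simpa using (hAmem 1).1 h1)
    exact hz0 ▸ P.asIdeal.zero_mem
  -- a prime containing a finite intersection of primes contains one of them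
  obtain ⟨I, -, hI⟩ := (Ideal.IsPrime.inf_le' P.2).1 hbot
  refine ⟨I, PrimeSpectrum.ext ?_⟩
  have := (f I).2
  exact (IsArtinianRing.isMaximal_of_isPrime (f I).asIdeal).eq_of_le P.2.ne_top hI

end SimpleComponents

/-! ### Group algebras of subgroups and the element `ε(H, K)` -/

section Restriction
variable {G : Type*} [Group G] (F : Type*) [Field F] (H : Subgroup G)

/-- The inclusion of group algebras `F[H] → F[G]`. -/
def inclusionHom : MonoidAlgebra F H →ₐ[F] MonoidAlgebra F G :=
  MonoidAlgebra.mapDomainAlgHom F F H.subtype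

/-- The `F`-linear projection `F[G] → F[H]` that forgets the coefficients outside `H`. -/
def restriction : MonoidAlgebra F G →ₗ[F] MonoidAlgebra F H where
  toFun x := x.comapDomain H.subtype H.subtype_injective
  map_add' := MonoidAlgebra.comapDomain_add _ _
  map_smul' c x := by ext; simp

variable {H}

@[simp] theorem inclusionHom_single (h : H) (r : F) :
    inclusionHom F H (.single h r) = .single (h : G) r :=
  MonoidAlgebra.mapDomain_single

theorem restriction_single_mem {g : G} (hg : g ∈ H) (r : F) :
    restriction F H (.single g r) = .single ⟨g, hg⟩ r :=
  MonoidAlgebra.comapDomain_single_map H.subtype H.subtype_injective ⟨g, hg⟩ r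

theorem restriction_single_notMem {g : G} (hg : g ∉ H) (r : F) :
    restriction F H (.single g r) = 0 :=
  MonoidAlgebra.comapDomain_single_of_not_mem_range (by simpa using hg) H.subtype_injective

theorem coeff_restriction (x : MonoidAlgebra F G) (h : H) :
    (restriction F H x).coeff h = x.coeff h := by
  simp [restriction]

variable {F}

@[simp] theorem restriction_inclusionHom (b : MonoidAlgebra F H) :
    restriction F H (inclusionHom F H b) = b := by
  induction b using MonoidAlgebra.induction_linear with
  | zero => simp
  | add x y hx hy => rw [map_add, map_add, hx, hy]
  | single h r => rw [inclusionHom_single, restriction_single_mem F h.2]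

theorem restriction_inclusionHom_mul (b : MonoidAlgebra F H) (x : MonoidAlgebra F G) :
    restriction F H (inclusionHom F H b * x) = b * restriction F H x := by
  induction b using MonoidAlgebra.induction_linear with
  | zero => simp
  | add b c hb hc => rw [map_add, add_mul, map_add, hb, hc, add_mul]
  | single h r =>
    induction x using MonoidAlgebra.induction_linear with
    | zero => simp
    | add x y hx hy => rw [mul_add, map_add, hx, hy, map_add, mul_add]
    | single g s =>
      rw [inclusionHom_single, MonoidAlgebra.single_mul_single]
      by_cases hg : g ∈ H
      · rw [restriction_single_mem F hg, restriction_single_mem F (H.mul_mem h.2 hg),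
          MonoidAlgebra.single_mul_single]
        rfl
      · rw [restriction_single_notMem F hg, restriction_single_notMem F
          (fun h' => hg ((H.mul_mem_cancel_left h.2).1 h')), mul_zero]

theorem restriction_mul_inclusionHom (x : MonoidAlgebra F G) (b : MonoidAlgebra F H) :
    restriction F H (x * inclusionHom F H b) = restriction F H x * b := by
  induction b using MonoidAlgebra.induction_linear with
  | zero => simp
  | add b c hb hc => rw [map_add, mul_add, map_add, hb, hc, mul_add]
  | single h r =>
    induction x using MonoidAlgebra.induction_linear with
    | zero => simp
    | add x y hx hy => rw [add_mul, map_add, hx, hy, map_add, add_mul]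
    | single g s =>
      rw [inclusionHom_single, MonoidAlgebra.single_mul_single]
      by_cases hg : g ∈ H
      · rw [restriction_single_mem F hg, restriction_single_mem F (H.mul_mem hg h.2),
          MonoidAlgebra.single_mul_single]
        rfl
      · rw [restriction_single_notMem F hg, restriction_single_notMem F
          (fun h' => hg ((H.mul_mem_cancel_right h.2).1 h')), zero_mul]

theorem mem_range_inclusionHom_iff {x : MonoidAlgebra F G} :
    x ∈ (inclusionHom F H).range ↔ ∀ g ∉ H, x.coeff g = 0 := by
  constructor
  · rintro ⟨b, rfl⟩ g hg
    induction b using MonoidAlgebra.induction_linear with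
    | zero => simp
    | add b c hb hc =>
      simp only [AlgHom.toRingHom_eq_coe, RingHom.coe_coe] at hb hc ⊢
      simp [hb, hc]
    | single h r =>
      simp only [AlgHom.toRingHom_eq_coe, RingHom.coe_coe, inclusionHom_single,
        MonoidAlgebra.coeff_single]
      exact Finsupp.single_eq_of_ne fun h' => hg (h' ▸ h.2)
  · intro hx
    refine ⟨restriction F H x, MonoidAlgebra.mapDomain_comapDomain ?_ H.subtype_injective⟩
    intro g hg
    simp only [Subgroup.coe_subtype, Subtype.range_coe_subtype]
    by_contra h
    exact (Finsupp.mem_support_iff.1 hg) (hx g h)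

theorem inclusionHom_restriction {x : MonoidAlgebra F G} (hx : x ∈ (inclusionHom F H).range) :
    inclusionHom F H (restriction F H x) = x := by
  obtain ⟨b, rfl⟩ := hx
  exact congrArg _ (restriction_inclusionHom b)

theorem single_mem_range {h : G} (hh : h ∈ H) (r : F) :
    (.single h r : MonoidAlgebra F G) ∈ (inclusionHom F H).range :=
  ⟨.single ⟨h, hh⟩ r, inclusionHom_single F _ _⟩

variable {L : Type*} [Field L] [Algebra F L]

/-- The linear extension to `F[G]` of a linear character of `H`, extended by zero outside `H`. -/
def charFunctional (F : Type*) [Field F] [Algebra F L] (χ : H →* L) : MonoidAlgebra F G →ₗ[F] L :=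
  (MonoidAlgebra.lift F L H χ).toLinearMap ∘ₗ restriction F H

theorem charFunctional_single {χ : H →* L} (h : H) :
    charFunctional F χ (.single (h : G) 1) = χ h := by
  simp [charFunctional, restriction_single_mem F h.2]

theorem charFunctional_one (χ : H →* L) : charFunctional F χ (1 : MonoidAlgebra F G) = 1 :=
  (charFunctional_single (1 : H)).trans χ.map_one

theorem charFunctional_mul_of_left_mem {χ : H →* L} {x y : MonoidAlgebra F G}
    (hx : x ∈ (inclusionHom F H).range) :
    charFunctional F χ (x * y) = charFunctional F χ x * charFunctional F χ y := by
  obtain ⟨b, rfl⟩ := hx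
  simp [charFunctional, restriction_inclusionHom_mul]

theorem charFunctional_mul_of_right_mem {χ : H →* L} {x y : MonoidAlgebra F G}
    (hy : y ∈ (inclusionHom F H).range) :
    charFunctional F χ (x * y) = charFunctional F χ x * charFunctional F χ y := by
  obtain ⟨b, rfl⟩ := hy
  simp [charFunctional, restriction_mul_inclusionHom]

end Restriction

section Eps
variable {G : Type*} [Group G] [Fintype G] (F : Type*) [Field F] [CharZero F] {H K M : Subgroup G}

/-- The inclusion of `ℚ[G]` in `F[G]`. -/
def scalarExt : MonoidAlgebra ℚ G →+* MonoidAlgebra F G :=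
  MonoidAlgebra.mapRingHom G (algebraMap ℚ F)

omit [Fintype G] in
@[simp] theorem scalarExt_single (g : G) (r : ℚ) :
    scalarExt F (.single g r) = .single g (algebraMap ℚ F r) := by
  simp [scalarExt]

theorem scalarExt_hat (M : Subgroup G) :
    scalarExt F (hat M) =
      (Nat.card M : F)⁻¹ • ∑ h : G with h ∈ M, MonoidAlgebra.single h (1 : F) := by
  rw [hat, Finset.smul_sum, Finset.smul_sum, map_sum]
  refine Finset.sum_congr rfl fun g _ => ?_
  simp

omit [Fintype G] in
theorem scalarExt_rat (x : MonoidAlgebra ℚ G) : scalarExt ℚ x = x := by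
  ext; simp [scalarExt]

variable {F}

theorem hat_mul_of_forall {x : MonoidAlgebra F G}
    (hx : ∀ m ∈ M, .single m 1 * x = x) : scalarExt F (hat M) * x = x := by
  have hc : (Nat.card M : F) ≠ 0 := Nat.cast_ne_zero.2 Nat.card_pos.ne'
  rw [scalarExt_hat, smul_mul_assoc, Finset.sum_mul,
    Finset.sum_congr rfl fun m hm => hx m (Finset.mem_filter.1 hm).2, Finset.sum_const,
    ← Fintype.card_subtype, ← Nat.card_eq_fintype_card, ← Nat.cast_smul_eq_nsmul F, smul_smul]
  exact (congrArg (· • x) (inv_mul_cancel₀ hc)).trans (one_smul F x)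

theorem mul_hat_of_forall {x : MonoidAlgebra F G}
    (hx : ∀ m ∈ M, x * .single m 1 = x) : x * scalarExt F (hat M) = x := by
  have hc : (Nat.card M : F) ≠ 0 := Nat.cast_ne_zero.2 Nat.card_pos.ne'
  rw [scalarExt_hat, mul_smul_comm, Finset.mul_sum,
    Finset.sum_congr rfl fun m hm => hx m (Finset.mem_filter.1 hm).2, Finset.sum_const,
    ← Fintype.card_subtype, ← Nat.card_eq_fintype_card, ← Nat.cast_smul_eq_nsmul F, smul_smul]
  exact (congrArg (· • x) (inv_mul_cancel₀ hc)).trans (one_smul F x)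

theorem single_mul_hat {m : G} (hm : m ∈ M) :
    MonoidAlgebra.single m 1 * hat M = hat M := by
  rw [hat, mul_smul_comm, Finset.mul_sum]
  congr 1
  refine Finset.sum_bij' (fun h _ => m * h) (fun h _ => m⁻¹ * h) ?_ ?_ ?_ ?_ ?_
  · intro a ha; simpa using M.mul_mem hm (by simpa using ha)
  · intro a ha; simpa using M.mul_mem (M.inv_mem hm) (by simpa using ha)
  · intro a _; group
  · intro a _; group
  · intro a _; simp [MonoidAlgebra.single_mul_single]

theorem hat_mul_single {m : G} (hm : m ∈ M) :
    hat M * MonoidAlgebra.single m 1 = hat M := by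
  rw [← (commute_single_hat (M.le_normalizer hm)).eq, single_mul_hat hm]

theorem hat_mul_hat_of_le {M' : Subgroup G} (h : M ≤ M') : hat M * hat M' = hat M' := by
  have := hat_mul_of_forall (F := ℚ) (M := M) (x := hat M')
    fun m hm => single_mul_hat (h hm)
  simpa only [scalarExt_rat] using this

theorem hat_mul_hat_of_ge {M' : Subgroup G} (h : M ≤ M') : hat M' * hat M = hat M' := by
  have := mul_hat_of_forall (F := ℚ) (M := M) (x := hat M')
    fun m hm => hat_mul_single (h hm)
  simpa only [scalarExt_rat] using this

theorem scalarExt_hat_mem_range (h : M ≤ H) : scalarExt F (hat M) ∈ (inclusionHom F H).range := by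
  rw [scalarExt_hat]
  exact Subalgebra.smul_mem _ (Subalgebra.sum_mem _ fun g hg =>
    single_mem_range (h (Finset.mem_filter.1 hg).2) _) _

/-- A multiplicative property holds for `ε(H, K)` if it holds for its factors. -/
theorem scalarExt_eps_induction {p : MonoidAlgebra F G → Prop} (hK : p (scalarExt F (hat K)))
    (hone : p 1)
    (hmul : ∀ x y, p x → p y → p (x * y))
    (hM : ∀ M, IsMinimalNormalOver H K M → p (1 - scalarExt F (hat M))) :
    p (scalarExt F (eps H K)) := by
  rw [eps, map_mul]
  refine hmul _ _ hK (Finset.noncommProd_induction _ _ _ (fun x => p (scalarExt F x)) ?_ ?_ ?_)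
  · intro x y hx hy
    rw [map_mul]; exact hmul _ _ hx hy
  · rw [map_one]; exact hone
  · intro M hM'
    rw [map_sub, map_one]
    exact hM M (by simpa using hM')

theorem scalarExt_eps_mem_range (hKH : K ≤ H) :
    scalarExt F (eps H K) ∈ (inclusionHom F H).range :=
  scalarExt_eps_induction (p := (· ∈ (inclusionHom F H).range)) (scalarExt_hat_mem_range hKH)
    (one_mem _) (fun _ _ => mul_mem)
    (fun _ hM => sub_mem (one_mem _) (scalarExt_hat_mem_range hM.prop.2.1))

/-- The definition of `ε(H, K)` with the commutation proof as a variable, so that the index set and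
the factors can be rewritten. -/
theorem eps_def (H K : Subgroup G) : ∃ comm, eps H K =
    hat K * (Finset.univ.filter fun M : Subgroup G => IsMinimalNormalOver H K M).noncommProd
      (fun M => 1 - hat M) comm := ⟨_, rfl⟩

theorem eps_mul_self (H K : Subgroup G) : eps H K * eps H K = eps H K := by
  have hcomm : ∀ M, IsMinimalNormalOver H K M → Commute (hat K) (1 - hat M) := fun M hM =>
    (Commute.one_right _).sub_right
      ((hat_mul_hat_of_le hM.prop.1.le).trans (hat_mul_hat_of_ge hM.prop.1.le).symm)
  have hidem : ∀ M : Subgroup G, (1 - hat M) * (1 - hat M) = 1 - hat M := fun M => by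
    rw [sub_mul, mul_sub, mul_sub, hat_mul_hat_of_le le_rfl]; simp
  obtain ⟨comm, h⟩ := eps_def H K
  rw [h, ((Finset.noncommProd_commute _ _ comm _
      fun M hM => hcomm M (by simpa using hM)).symm).mul_mul_mul_comm,
    hat_mul_hat_of_le le_rfl, ← Finset.noncommProd_mul_distrib]
  · congr 1
    exact Finset.noncommProd_congr rfl (fun M _ => hidem M) _
  · intro M hM M' hM' _
    have h : IsMinimalNormalOver H K M := by simpa using hM
    have h' : IsMinimalNormalOver H K M' := by simpa using hM'
    exact (Commute.one_left _).sub_left ((Commute.one_right _).sub_right (commute_hat h' h).symm)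

theorem single_mul_eps {k : G} (hk : k ∈ K) : MonoidAlgebra.single k 1 * eps H K = eps H K := by
  rw [eps, ← mul_assoc, single_mul_hat hk]

theorem exists_eps_eq_mul (hM : IsMinimalNormalOver H K M) :
    ∃ x, eps H K = x * (1 - hat M) := by
  obtain ⟨comm, h⟩ := eps_def H K
  rw [h, ← Finset.noncommProd_erase_mul _ (a := M) (by simpa using hM), ← mul_assoc]
  exact ⟨_, rfl⟩

omit [Fintype G] in
theorem mapDomainRingHom_conj (n : G) (x : MonoidAlgebra ℚ G) :
    MonoidAlgebra.mapDomainRingHom ℚ (MulAut.conj n).toMonoidHom x =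
      .single n 1 * x * .single n⁻¹ 1 := by
  induction x using MonoidAlgebra.induction_linear with
  | zero => simp
  | add x y hx hy => rw [map_add, hx, hy, mul_add, add_mul]
  | single g r => simp [MonoidAlgebra.single_mul_single]

theorem mapDomainRingHom_conj_hat (n : G) (M : Subgroup G) :
    MonoidAlgebra.mapDomainRingHom ℚ (MulAut.conj n).toMonoidHom (hat M) =
      hat (M.map (MulAut.conj n).toMonoidHom) := by
  have hcard : Nat.card (M.map (MulAut.conj n).toMonoidHom) = Nat.card M :=
    Subgroup.card_map_of_injective (MulAut.conj n).injective
  rw [hat, hat, hcard, mapDomainRingHom_conj, mul_smul_comm, smul_mul_assoc, Finset.mul_sum,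
    Finset.sum_mul]
  congr 1
  refine Finset.sum_bij' (fun h _ => n * h * n⁻¹) (fun h _ => n⁻¹ * h * n) ?_ ?_ ?_ ?_ ?_
  · intro a ha
    simpa using ha
  · intro a ha
    obtain ⟨b, hb, rfl⟩ := (Finset.mem_filter.1 ha).2
    simpa [mul_assoc] using hb
  · intro a _; group
  · intro a _; group
  · intro a _; simp [MonoidAlgebra.single_mul_single]

omit [Fintype G] in
theorem map_conj_eq_self {n : G} (hH : n ∈ Subgroup.normalizer (H : Set G)) :
    H.map (MulAut.conj n).toMonoidHom = H := by
  ext x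
  rw [Subgroup.mem_map_equiv]
  simpa [mul_assoc] using (Subgroup.mem_normalizer_iff.1 hH (n⁻¹ * x * n))

omit [Fintype G] in
theorem _root_.Subgroup.normal_subgroupOf_map {A B : Subgroup G} (e : G ≃* G)
    (h : (A.subgroupOf B).Normal) :
    ((A.map e.toMonoidHom).subgroupOf (B.map e.toMonoidHom)).Normal := by
  constructor
  rintro ⟨_, a, ha, rfl⟩ hx ⟨_, b, hb, rfl⟩
  obtain ⟨a', ha', haa'⟩ := Subgroup.mem_subgroupOf.1 hx
  obtain rfl : a' = a := e.injective haa'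
  exact ⟨_, h.conj_mem ⟨a', ha⟩ ha' ⟨b, hb⟩, by simp; rfl⟩

omit [Fintype G] in
/-- Conjugation by an element that normalizes `H` and `K` permutes the minimal nontrivial normal
subgroups of `H / K`. -/
theorem isMinimalNormalOver_map {n : G} (hH : n ∈ Subgroup.normalizer (H : Set G))
    (hK : n ∈ Subgroup.normalizer (K : Set G)) (hM : IsMinimalNormalOver H K M) :
    IsMinimalNormalOver H K (M.map (MulAut.conj n).toMonoidHom) := by
  have key : ∀ {n : G}, n ∈ Subgroup.normalizer (H : Set G) →
      n ∈ Subgroup.normalizer (K : Set G) → ∀ {M : Subgroup G},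
      (K < M ∧ M ≤ H ∧ (M.subgroupOf H).Normal) →
      (K < M.map (MulAut.conj n).toMonoidHom ∧ M.map (MulAut.conj n).toMonoidHom ≤ H ∧
        ((M.map (MulAut.conj n).toMonoidHom).subgroupOf H).Normal) := by
    intro n hH hK M ⟨h1, h2, h3⟩
    refine ⟨?_, ?_, ?_⟩
    · conv_lhs => rw [← map_conj_eq_self hK]
      exact (Subgroup.map_lt_map_iff_of_injective (MulAut.conj n).injective).2 h1
    · conv_rhs => rw [← map_conj_eq_self hH]
      exact Subgroup.map_mono h2
    · have := Subgroup.normal_subgroupOf_map (MulAut.conj n) h3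
      rwa [map_conj_eq_self hH] at this
  refine ⟨key hH hK hM.prop, fun M' hM' hle => ?_⟩
  have h1 := key (inv_mem hH) (inv_mem hK) hM'
  have hcancel : ∀ (m : G) (A : Subgroup G),
      (A.map (MulAut.conj m).toMonoidHom).map (MulAut.conj m⁻¹).toMonoidHom = A := fun m A => by
    rw [Subgroup.map_map]
    convert A.map_id
    ext x; simp [mul_assoc]
  have h2 := hM.le_of_le h1 ((Subgroup.map_mono hle).trans_eq (hcancel n M))
  refine (Subgroup.map_mono h2).trans_eq ?_
  have := hcancel n⁻¹ M'
  rwa [inv_inv] at this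

/-- An element that normalizes `H` and `K` commutes with `ε(H, K)`, as conjugation by it permutes
the factors. -/
theorem commute_single_eps {n : G} (hH : n ∈ Subgroup.normalizer (H : Set G))
    (hK : n ∈ Subgroup.normalizer (K : Set G)) :
    Commute (MonoidAlgebra.single n (1 : ℚ)) (eps H K) := by
  let φ := MonoidAlgebra.mapDomainRingHom ℚ (MulAut.conj n).toMonoidHom
  let s := Finset.univ.filter fun M : Subgroup G => IsMinimalNormalOver H K M
  let σ : Subgroup G → Subgroup G := Subgroup.map (MulAut.conj n).toMonoidHom
  have hσ : Function.Injective σ := Subgroup.map_injective (MulAut.conj n).injective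
  have hs : s.val.map σ = s.val := by
    have : s.map ⟨σ, hσ⟩ = s := Finset.eq_of_subset_of_card_le (fun M hM => by
      obtain ⟨M', hM', rfl⟩ := Finset.mem_map.1 hM
      exact Finset.mem_filter.2 ⟨Finset.mem_univ _,
        isMinimalNormalOver_map hH hK (Finset.mem_filter.1 hM').2⟩) (by simp)
    simpa using congrArg Finset.val this
  have hφ : φ (eps H K) = eps H K := by
    obtain ⟨comm, h⟩ := eps_def H K
    rw [h, map_mul, Finset.map_noncommProd]
    congr 1
    · rw [mapDomainRingHom_conj_hat, map_conj_eq_self hK]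
    · unfold Finset.noncommProd
      congr 1
      calc s.val.map (fun M => φ (1 - hat M)) = s.val.map (fun M => 1 - hat (σ M)) := by
            refine Multiset.map_congr rfl fun M _ => ?_
            rw [map_sub, map_one, mapDomainRingHom_conj_hat]
        _ = (s.val.map σ).map (fun M => 1 - hat M) := by rw [Multiset.map_map]; rfl
        _ = s.val.map (fun M => 1 - hat M) := by rw [hs]
  have h2 : MonoidAlgebra.single n 1 * eps H K * .single n⁻¹ 1 = eps H K :=
    (mapDomainRingHom_conj n _).symm.trans hφ
  calc MonoidAlgebra.single n 1 * eps H K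
      = MonoidAlgebra.single n 1 * eps H K * .single n⁻¹ 1 * .single n 1 := by
        simp [mul_assoc, MonoidAlgebra.single_mul_single, ← MonoidAlgebra.one_def]
    _ = _ := by rw [h2]

end Eps

/-! ### Strong Shoda pairs -/

namespace IsStrongShodaPair
variable {G : Type*} [Group G] [Fintype G] {H K : Subgroup G}

theorem normalizer_le (h : IsStrongShodaPair H K) :
    Subgroup.normalizer (K : Set G) ≤ Subgroup.normalizer (H : Set G) :=
  (Subgroup.normal_subgroupOf_iff_le_normalizer h.le_normalizer).1 h.normal

theorem conj_mem (h : IsStrongShodaPair H K) {n x : G}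
    (hn : n ∈ Subgroup.normalizer (K : Set G)) (hx : x ∈ H) : n * x * n⁻¹ ∈ H :=
  (Subgroup.mem_normalizer_iff.1 (h.normalizer_le hn) x).1 hx

/-- The class of `x` in `N_G(K) / K`. -/
def mkQ (K : Subgroup G) (x : G) (hx : x ∈ Subgroup.normalizer (K : Set G)) :
    Subgroup.normalizer (K : Set G) ⧸ K.subgroupOf (Subgroup.normalizer (K : Set G)) :=
  QuotientGroup.mk' (K.subgroupOf (Subgroup.normalizer (K : Set G))) ⟨x, hx⟩

omit [Fintype G] in
theorem mkQ_pow {x : G} (hx : x ∈ Subgroup.normalizer (K : Set G)) (i : ℕ) :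
    mkQ K x hx ^ i = mkQ K (x ^ i) (pow_mem hx i) := rfl

omit [Fintype G] in
theorem mkQ_eq_mkQ {x y : G} {hx : x ∈ Subgroup.normalizer (K : Set G)}
    {hy : y ∈ Subgroup.normalizer (K : Set G)} :
    mkQ K x hx = mkQ K y hy ↔ x⁻¹ * y ∈ K := by
  unfold mkQ
  rw [QuotientGroup.mk'_apply, QuotientGroup.mk'_apply, QuotientGroup.eq]
  exact Iff.rfl

omit [Fintype G] in
theorem mem_quotientInNormalizer {a} :
    a ∈ quotientInNormalizer H K ↔ ∃ x ∈ H, ∃ hx, a = mkQ K x hx := by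
  constructor
  · rintro ⟨⟨x, hxN⟩, hx, rfl⟩
    exact ⟨x, hx, hxN, rfl⟩
  · rintro ⟨x, hx, hxN, rfl⟩
    exact ⟨⟨x, hxN⟩, hx, rfl⟩

/-- A representative in `H` of a generator of the cyclic group `H / K`. -/
theorem exists_generator (h : IsStrongShodaPair H K) :
    ∃ x ∈ H, ∀ y ∈ H, ∃ i : ℕ, (x ^ i)⁻¹ * y ∈ K := by
  obtain ⟨⟨a, ha⟩, hgen⟩ := h.cyclic.exists_generator
  obtain ⟨x, hx, hxN, rfl⟩ := mem_quotientInNormalizer.1 ha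
  refine ⟨x, hx, fun y hy => ?_⟩
  have hyN := h.le_normalizer hy
  obtain ⟨i, hi⟩ := (mem_powers_iff_mem_zpowers (x := (⟨mkQ K x hxN, ha⟩ :
    quotientInNormalizer H K))).2 (hgen ⟨mkQ K y hyN, mem_quotientInNormalizer.2 ⟨y, hy, hyN, rfl⟩⟩)
  have hi' : mkQ K x hxN ^ i = mkQ K y hyN := congrArg Subtype.val hi
  exact ⟨i, mkQ_eq_mkQ.1 ((mkQ_pow hxN i).symm.trans hi')⟩

/-- The quotient `H / K` is abelian, being cyclic. -/
theorem commutator_mem (h : IsStrongShodaPair H K) {x y : G} (hx : x ∈ H) (hy : y ∈ H) :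
    (y * x)⁻¹ * (x * y) ∈ K := by
  have hxN := h.le_normalizer hx
  have hyN := h.le_normalizer hy
  have := h.cyclic
  refine (mkQ_eq_mkQ (hx := mul_mem hyN hxN) (hy := mul_mem hxN hyN)).1 ?_
  have := congrArg Subtype.val (IsCyclic.commGroup.mul_comm
    (⟨mkQ K y hyN, mem_quotientInNormalizer.2 ⟨y, hy, hyN, rfl⟩⟩ : quotientInNormalizer H K)
    ⟨mkQ K x hxN, mem_quotientInNormalizer.2 ⟨x, hx, hxN, rfl⟩⟩)
  exact this

/-- As `H / K` is maximal abelian in `N_G(K) / K`, it contains its centralizer. -/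
theorem mem_of_forall_commutator_mem (h : IsStrongShodaPair H K) {n : G}
    (hn : n ∈ Subgroup.normalizer (K : Set G)) (hc : ∀ x ∈ H, (x * n)⁻¹ * (n * x) ∈ K) : n ∈ H := by
  let S := insert (mkQ K n hn) (quotientInNormalizer H K : Set _)
  have := h.cyclic
  have hcomm : ∀ a ∈ quotientInNormalizer H K, mkQ K n hn * a = a * mkQ K n hn := by
    intro a ha
    obtain ⟨x, hx, hxN, rfl⟩ := mem_quotientInNormalizer.1 ha
    exact (mkQ_eq_mkQ (hx := mul_mem hxN hn) (hy := mul_mem hn hxN)).2 (hc x hx) |>.symm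
  have hS : IsMulCommutative (Subgroup.closure S) := by
    refine Subgroup.isMulCommutative_closure ?_
    rintro a (rfl | ha) b (rfl | hb)
    · rfl
    · exact hcomm b hb
    · exact (hcomm a ha).symm
    · exact congrArg Subtype.val (IsCyclic.commGroup.mul_comm
        (⟨a, ha⟩ : quotientInNormalizer H K) ⟨b, hb⟩)
  have hle := h.maximal.le_of_ge hS
    (fun a ha => Subgroup.subset_closure (Set.mem_insert_of_mem _ ha))
    (Subgroup.subset_closure (Set.mem_insert _ _))
  obtain ⟨x, hx, hxN, hnx⟩ := mem_quotientInNormalizer.1 hle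
  have : n⁻¹ * x ∈ H := h.le (mkQ_eq_mkQ.1 hnx)
  simpa using mul_mem hx (inv_mem this)

/-- Every subgroup containing `K` and an element of `H` outside `K` contains some `M` with `M / K`
minimal normal in `H / K`: as `H / K` is abelian, normality is automatic. -/
theorem exists_isMinimalNormalOver (h : IsStrongShodaPair H K) {c : G} (hc : c ∈ H)
    (hcK : c ∉ K) {A : Subgroup G} (hKA : K ≤ A) (hcA : c ∈ A) :
    ∃ M ≤ A, IsMinimalNormalOver H K M := by
  have hB : K < A ⊓ H := lt_of_le_of_ne (le_inf hKA h.le) fun h' => hcK (h' ▸ ⟨hcA, hc⟩)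
  obtain ⟨M, hMB, hM⟩ := Finite.exists_le_minimal
    (p := fun M : Subgroup G => K < M ∧ M ≤ H ∧ (M.subgroupOf H).Normal) (a := A ⊓ H)
    ⟨hB, inf_le_right, by
      refine (Subgroup.normal_subgroupOf_iff inf_le_right).2 fun x y hx hy => ?_
      have := mul_mem hx (hB.le (h.commutator_mem (x := x) (y := y⁻¹) hx.2 (inv_mem hy)))
      simpa [mul_assoc] using this⟩
  exact ⟨M, hMB.trans inf_le_left, hM⟩

section FieldEps
variable {F : Type*} [Field F] [CharZero F]

theorem eps_mul_eps (H K : Subgroup G) :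
    scalarExt F (eps H K) * scalarExt F (eps H K) = scalarExt F (eps H K) := by
  rw [← map_mul, eps_mul_self]

theorem single_mul_scalarExt_eps {k : G} (hk : k ∈ K) :
    .single k 1 * scalarExt F (eps H K) = scalarExt F (eps H K) := by
  have := congrArg (scalarExt F) (single_mul_eps (H := H) hk)
  simpa using this

theorem commute_single_scalarExt_eps (h : IsStrongShodaPair H K) {n : G}
    (hn : n ∈ Subgroup.normalizer (K : Set G)) :
    Commute (.single n 1) (scalarExt F (eps H K)) := by
  have := (commute_single_eps (h.normalizer_le hn) hn).map (scalarExt F)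
  simpa using this

/-- The orthogonality of the conjugates of `ε(H, K)`, in the form `ε g ε = 0` for
`g ∉ N_G(K)`. -/
theorem eps_mul_single_mul_eps (h : IsStrongShodaPair H K) {g : G}
    (hg : g ∉ Subgroup.normalizer (K : Set G)) :
    scalarExt F (eps H K) * .single g 1 * scalarExt F (eps H K) = 0 := by
  have h1 := h.ortho g⁻¹ (fun h' => hg (by simpa using inv_mem h'))
  rw [conj, inv_inv] at h1
  have h2 : eps H K * .single g 1 * eps H K = 0 := by
    calc eps H K * .single g 1 * eps H K
        = eps H K * (.single g 1 * eps H K * .single g⁻¹ 1) * .single g 1 := by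
          simp [mul_assoc, MonoidAlgebra.single_mul_single, ← MonoidAlgebra.one_def]
      _ = 0 := by rw [h1, zero_mul]
  simpa using congrArg (scalarExt F) h2

/-- `ε(H, K)` kills whatever is fixed by an element of `H` outside `K`. -/
theorem eq_zero_of_single_mul_eq (h : IsStrongShodaPair H K) {c : G} (hc : c ∈ H) (hcK : c ∉ K)
    {a : MonoidAlgebra F G} (hca : .single c 1 * a = a) (ha : scalarExt F (eps H K) * a = a) :
    a = 0 := by
  -- the stabilizer of `a` contains `K` and `c`, hence some `M` whose factor `1 - M̂` kills `a`
  let A : Subgroup G :=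
    { carrier := {g | .single g 1 * a = a}
      one_mem' := by
        simp only [Set.mem_ofPred_eq]; rw [← MonoidAlgebra.one_def, one_mul]
      mul_mem' := fun {x y} hx hy => by
        simp only [Set.mem_ofPred_eq] at hx hy ⊢
        rw [← one_mul (1 : F), ← MonoidAlgebra.single_mul_single, mul_assoc, hy, hx]
      inv_mem' := fun {x} hx => by
        simp only [Set.mem_ofPred_eq] at hx ⊢
        conv_lhs => rw [← hx]
        rw [← mul_assoc, MonoidAlgebra.single_mul_single, inv_mul_cancel, one_mul,
          ← MonoidAlgebra.one_def, one_mul] }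
  have hKA : K ≤ A := fun k hk => by
    change .single k 1 * a = a
    rw [← ha, ← mul_assoc, single_mul_scalarExt_eps hk]
  obtain ⟨M, hMA, hM⟩ := h.exists_isMinimalNormalOver hc hcK hKA hca
  obtain ⟨x, hx⟩ := exists_eps_eq_mul hM
  rw [← ha, hx, map_mul, map_sub, map_one, mul_assoc, sub_mul, one_mul,
    hat_mul_of_forall fun m hm => hMA hm, sub_self, mul_zero]

theorem commute_eps_inclusionHom (h : IsStrongShodaPair H K) (x : MonoidAlgebra F H) :
    Commute (scalarExt F (eps H K)) (inclusionHom F H x) := by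
  induction x using MonoidAlgebra.induction_linear with
  | zero => simp
  | add x y hx hy => rw [map_add]; exact hx.add_right hy
  | single g r =>
    have : (.single (g : G) r : MonoidAlgebra F G) = r • .single (g : G) 1 := by simp
    rw [inclusionHom_single, this]
    exact (h.commute_single_scalarExt_eps (h.le_normalizer g.2)).symm.smul_right r

/-- `F[H] ε(H, K)` is commutative. -/
theorem mul_mul_eps_comm (h : IsStrongShodaPair H K) (x y : MonoidAlgebra F H) :
    inclusionHom F H x * inclusionHom F H y * scalarExt F (eps H K) =
      inclusionHom F H y * inclusionHom F H x * scalarExt F (eps H K) := by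
  induction x using MonoidAlgebra.induction_linear with
  | zero => simp
  | add x x' hx hx' => simp only [map_add, add_mul, mul_add, hx, hx']
  | single g r =>
    induction y using MonoidAlgebra.induction_linear with
    | zero => simp
    | add x x' hx hx' => simp only [map_add, add_mul, mul_add, hx, hx']
    | single g' s =>
      simp only [inclusionHom_single, MonoidAlgebra.single_mul_single]
      have hK := h.commutator_mem g.2 g'.2
      have : (.single ((g : G) * g') (r * s) : MonoidAlgebra F G) =
          .single (g' * g : G) (s * r) * .single ((g' * g : G)⁻¹ * (g * g')) 1 := by
        rw [MonoidAlgebra.single_mul_single, mul_one, mul_comm r s, mul_inv_cancel_left]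
      rw [this, mul_assoc, single_mul_scalarExt_eps hK]

/-- The elements `z ε(H, K)` with `z` in the centre of `F[G]` lie in `F[H]`. -/
theorem center_mul_eps_mem (h : IsStrongShodaPair H K) {z : MonoidAlgebra F G}
    (hz : ∀ x, x * z = z * x) : z * scalarExt F (eps H K) ∈ (inclusionHom F H).range := by
  set ε := scalarExt F (eps H K) with hε
  have hεε : ε * ε = ε := eps_mul_eps H K
  have hεr : ε ∈ (inclusionHom F H).range := scalarExt_eps_mem_range h.le
  have hεw : ε * (z * ε) = z * ε := by rw [← mul_assoc, hz ε, mul_assoc, hεε]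
  refine mem_range_inclusionHom_iff.2 fun n hnH => ?_
  by_cases hn : n ∈ Subgroup.normalizer (K : Set G)
  · -- Conjugation by `n` is not trivial on `H / K`. Let `u n` be the part of `z ε` on the coset
    -- `H n`. As `z ε` commutes with `x`, `u` is fixed by `x'⁻¹ x ∉ K`, and `ε u = u`; so `u = 0`.
    obtain ⟨x, hx, hxK⟩ : ∃ x ∈ H, (x * n)⁻¹ * (n * x) ∉ K := by
      by_contra! hcon
      exact hnH (h.mem_of_forall_commutator_mem hn hcon)
    set x' : G := n * x * n⁻¹ with hx'
    have hx'H : x' ∈ H := h.conj_mem hn hx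
    have hxN := h.le_normalizer hx
    set u := restriction F H (z * ε * .single n⁻¹ 1) with hu
    have hεu : restriction F H ε * u = u := by
      rw [hu, ← restriction_inclusionHom_mul, inclusionHom_restriction hεr, ← mul_assoc, hεw]
    have hxu : .single ⟨x, hx⟩ 1 * u = u * .single ⟨x', hx'H⟩ 1 := by
      rw [hu, ← restriction_inclusionHom_mul, ← restriction_mul_inclusionHom, inclusionHom_single,
        inclusionHom_single]
      congr 1
      have h1 : .single x 1 * (z * ε) = z * ε * .single x 1 := by
        rw [← mul_assoc, hz, mul_assoc, (h.commute_single_scalarExt_eps hxN).eq, mul_assoc]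
      rw [← mul_assoc, h1, mul_assoc, mul_assoc (z * ε), MonoidAlgebra.single_mul_single,
        MonoidAlgebra.single_mul_single]
      simp [hx', mul_assoc]
    set a := inclusionHom F H u with ha
    have hεa : ε * a = a := by
      have := congrArg (inclusionHom F H) hεu
      rwa [map_mul, inclusionHom_restriction hεr] at this
    have hxa : .single x 1 * a = a * .single x' 1 := by
      have := congrArg (inclusionHom F H) hxu
      simpa only [map_mul, inclusionHom_single] using this
    have haε : a * ε = a := by
      rw [ha, ← (h.commute_eps_inclusionHom u).eq, ← ha, hεa]
    have hax' : a * .single x' 1 = .single x' 1 * a := by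
      have := h.mul_mul_eps_comm u (.single ⟨x', hx'H⟩ 1)
      rw [inclusionHom_single, mul_assoc, mul_assoc, ← ha, ← hε, haε,
        (h.commute_single_scalarExt_eps (h.le_normalizer hx'H)).eq, ← mul_assoc, haε] at this
      exact this
    have ha0 : a = 0 := by
      refine h.eq_zero_of_single_mul_eq (c := x'⁻¹ * x) (mul_mem (inv_mem hx'H) hx) ?_ ?_ hεa
      · intro hK
        apply hxK
        have := inv_mem ((Subgroup.mem_normalizer_iff.1
          (mul_mem (mul_mem (inv_mem hxN) (inv_mem hn)) hxN) _).1 hK)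
        simpa [hx', mul_assoc] using this
      · rw [← one_mul (1 : F), ← MonoidAlgebra.single_mul_single, mul_assoc, hxa, hax',
          ← mul_assoc, MonoidAlgebra.single_mul_single, inv_mul_cancel, one_mul,
          ← MonoidAlgebra.one_def, one_mul]
    have hu0 : u = 0 := by
      rw [← restriction_inclusionHom u, ← ha, ha0, map_zero]
    have h1 := coeff_restriction F (H := H) (z * ε * .single n⁻¹ 1) 1
    rw [← hu, hu0] at h1
    simpa using h1.symm
  · -- outside `N_G(K)`, the coefficients of `z ε = ε z ε` vanish by orthogonality
    have key : ∀ x : MonoidAlgebra F G,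
        ε * x * ε ∈ (inclusionHom F (Subgroup.normalizer (K : Set G))).range := by
      intro x
      have hεN : ε ∈ (inclusionHom F (Subgroup.normalizer (K : Set G))).range :=
        mem_range_inclusionHom_iff.2 fun g hg =>
          mem_range_inclusionHom_iff.1 hεr g fun h' => hg (h.le_normalizer h')
      induction x using MonoidAlgebra.induction_linear with
      | zero => simp
      | add x y hx hy => rw [mul_add, add_mul]; exact add_mem hx hy
      | single g r =>
        by_cases hg : g ∈ Subgroup.normalizer (K : Set G)
        · exact mul_mem (mul_mem hεN (single_mem_range hg r)) hεN
        · have : (.single g r : MonoidAlgebra F G) = r • .single g 1 := by simp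
          rw [this, mul_smul_comm, smul_mul_assoc, h.eps_mul_single_mul_eps hg, smul_zero]
          exact zero_mem _
    have := mem_range_inclusionHom_iff.1 (key z) n hn
    rwa [mul_assoc, hεw] at this

end FieldEps
end IsStrongShodaPair

/-! ### Linear characters with kernel `K` -/

namespace IsStrongShodaPair
variable {G : Type*} [Group G] [Fintype G] {H K : Subgroup G}

section Characters
variable {L : Type*} [Field L]

omit [Fintype G] in
theorem ker_eq_iff {ψ : H →* Lˣ} : ψ.ker = K.subgroupOf H ↔ ∀ x : H, ψ x = 1 ↔ (x : G) ∈ K := by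
  rw [SetLike.ext_iff]
  exact forall_congr' fun x => by rw [MonoidHom.mem_ker, Subgroup.mem_subgroupOf]

omit [Fintype G] in
theorem apply_eq_apply_iff {ψ : H →* Lˣ} (hψ : ψ.ker = K.subgroupOf H) {x y : H} :
    ψ x = ψ y ↔ (x : G)⁻¹ * y ∈ K := by
  rw [← Subgroup.coe_inv, ← Subgroup.coe_mul, ← ker_eq_iff.1 hψ, map_mul, map_inv,
    inv_mul_eq_one]

/-- A generator `x` of `H` modulo `K`; every linear character of `H` with kernel `K` has a
primitive `[H : K]`-th root of unity as its value at `x`. -/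
theorem exists_orderOf_eq (h : IsStrongShodaPair H K) :
    ∃ x : H, (∀ y : H, ∃ i : ℕ, ((x : G) ^ i)⁻¹ * y ∈ K) ∧
      ∀ (ψ : H →* Lˣ), ψ.ker = K.subgroupOf H → orderOf (ψ x) = K.relIndex H := by
  obtain ⟨x, hx, hgen⟩ := h.exists_generator
  refine ⟨⟨x, hx⟩, fun y => hgen y y.2, fun ψ hψ => ?_⟩
  have hrange : ψ.range = Subgroup.zpowers (ψ ⟨x, hx⟩) := by
    refine le_antisymm ?_ ?_
    · rintro _ ⟨y, rfl⟩
      obtain ⟨i, hi⟩ := hgen y y.2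
      refine ⟨i, ?_⟩
      simp only [zpow_natCast]
      rw [← map_pow]
      exact (apply_eq_apply_iff hψ).2 hi
    · rw [Subgroup.zpowers_le]
      exact ⟨_, rfl⟩
  rw [← Nat.card_zpowers, ← hrange, ← Subgroup.index_ker, hψ, Subgroup.relIndex]

omit [Fintype G] in
theorem pow_relIndex_eq_one {ψ : H →* Lˣ} (hψ : ψ.ker = K.subgroupOf H) (y : H) :
    ψ y ^ K.relIndex H = 1 := by
  have : ψ.ker.index = Nat.card ψ.range := Subgroup.index_ker ψ
  rw [Subgroup.relIndex, ← hψ, this]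
  exact congrArg Subtype.val (pow_card_eq_one' (x := (⟨ψ y, y, rfl⟩ : ψ.range)))

omit [Fintype G] in
theorem eq_of_apply_eq {x : H} (hx : ∀ y : H, ∃ i : ℕ, ((x : G) ^ i)⁻¹ * y ∈ K)
    {ψ χ : H →* Lˣ} (hψ : K.subgroupOf H ≤ ψ.ker) (hχ : K.subgroupOf H ≤ χ.ker)
    (hval : ψ x = χ x) : ψ = χ := by
  ext1 y
  obtain ⟨i, hi⟩ := hx y
  have hy : y = x ^ i * ((x ^ i)⁻¹ * y) := by group
  have h1 : (x ^ i)⁻¹ * y ∈ K.subgroupOf H := hi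
  have h2 : ψ ((x ^ i)⁻¹ * y) = 1 := hψ h1
  have h3 : χ ((x ^ i)⁻¹ * y) = 1 := hχ h1
  rw [hy, map_mul ψ (x ^ i), map_mul χ (x ^ i), h2, h3, map_pow, map_pow, hval]

theorem exists_character (h : IsStrongShodaPair H K) {ζ : L}
    (hζ : IsPrimitiveRoot ζ (K.relIndex H)) : ∃ θ : H →* Lˣ, θ.ker = K.subgroupOf H := by
  have hnormal : (K.subgroupOf H).Normal :=
    (Subgroup.normal_subgroupOf_iff_le_normalizer h.le).2 h.le_normalizer
  obtain ⟨x, hx, hgen⟩ := h.exists_generator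
  let q : H ⧸ K.subgroupOf H := QuotientGroup.mk ⟨x, hx⟩
  have hq : ∀ y, y ∈ Subgroup.zpowers q := by
    intro y
    induction y using QuotientGroup.induction_on with
    | H y =>
      obtain ⟨i, hi⟩ := hgen y y.2
      refine ⟨i, ?_⟩
      simp only [zpow_natCast]
      exact QuotientGroup.eq.2 hi
  have horder : orderOf q = K.relIndex H := orderOf_eq_card_of_forall_mem_zpowers hq
  have hζ' := hζ.isUnit_unit (NeZero.ne _)
  have hord' : orderOf (hζ.isUnit (NeZero.ne _)).unit = orderOf q := by
    rw [horder]; exact hζ'.eq_orderOf.symm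
  let f : (H ⧸ K.subgroupOf H) →* Lˣ := monoidHomOfForallMemZpowers hq hord'.dvd
  have hf : Function.Injective f := by
    refine (injective_iff_map_eq_one f).2 fun y hy => ?_
    obtain ⟨i, rfl⟩ := hq y
    simp only at hy ⊢
    rw [map_zpow, monoidHomOfForallMemZpowers_apply_gen, ← orderOf_dvd_iff_zpow_eq_one, hord',
      orderOf_dvd_iff_zpow_eq_one] at hy
    exact hy
  refine ⟨f.comp (QuotientGroup.mk' _), ?_⟩
  rw [← MonoidHom.comap_ker, (MonoidHom.ker_eq_bot_iff f).2 hf, MonoidHom.comap_bot,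
    QuotientGroup.ker_mk']

omit [Fintype G] in
theorem ker_pow_units {θ : H →* Lˣ} (hθ : θ.ker = K.subgroupOf H)
    (u : (ZMod (K.relIndex H))ˣ) :
    (θ ^ (u : ZMod (K.relIndex H)).val).ker = K.subgroupOf H := by
  rw [ker_eq_iff]
  intro y
  rw [← ker_eq_iff.1 hθ, MonoidHom.pow_apply]
  have hcop : Nat.Coprime (u : ZMod (K.relIndex H)).val (orderOf (θ y)) :=
    (ZMod.val_coe_unit_coprime u).coprime_dvd_right
      (orderOf_dvd_of_pow_eq_one (pow_relIndex_eq_one hθ y))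
  refine ⟨fun h1 => ?_, fun h1 => by rw [h1, one_pow]⟩
  exact orderOf_eq_one_iff.1 (Nat.eq_one_of_dvd_coprimes hcop.symm dvd_rfl
    (orderOf_dvd_of_pow_eq_one h1))

theorem pow_eq_pow_iff (h : IsStrongShodaPair H K) {θ : H →* Lˣ} (hθ : θ.ker = K.subgroupOf H)
    {a b : ℕ} : θ ^ a = θ ^ b ↔ (a : ZMod (K.relIndex H)) = b := by
  obtain ⟨x, hx, hord⟩ := h.exists_orderOf_eq (L := L)
  have hle : ∀ c, K.subgroupOf H ≤ (θ ^ c).ker := fun c y hy => by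
    rw [← hθ] at hy
    rw [MonoidHom.mem_ker, MonoidHom.pow_apply, hy, one_pow]
  rw [ZMod.natCast_eq_natCast_iff, ← hord θ hθ, ← pow_eq_pow_iff_modEq]
  exact ⟨fun h' => DFunLike.congr_fun h' x, fun h' => eq_of_apply_eq hx (hle a) (hle b) h'⟩

omit [Fintype G] in
theorem apply_pow_eq_of_cast_eq {θ : H →* Lˣ} (hθ : θ.ker = K.subgroupOf H)
    {a b : ℕ} (hab : (a : ZMod (K.relIndex H)) = b) (y : H) : θ y ^ a = θ y ^ b := by
  rw [pow_eq_pow_iff_modEq]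
  exact ((ZMod.natCast_eq_natCast_iff _ _ _).1 hab).of_dvd
    (orderOf_dvd_of_pow_eq_one (pow_relIndex_eq_one hθ y))

/-- The linear characters of `H` with kernel `K` form a torsor under `(ℤ/[H : K]ℤ)ˣ`. -/
theorem exists_eq_pow (h : IsStrongShodaPair H K) {θ ψ : H →* Lˣ} (hθ : θ.ker = K.subgroupOf H)
    (hψ : ψ.ker = K.subgroupOf H) :
    ∃ u : (ZMod (K.relIndex H))ˣ, ψ = θ ^ (u : ZMod (K.relIndex H)).val := by
  obtain ⟨x, hx, hord⟩ := h.exists_orderOf_eq (L := L)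
  have h1 : IsPrimitiveRoot (θ x : L) (K.relIndex H) := by
    rw [← hord θ hθ, ← orderOf_units]; exact IsPrimitiveRoot.orderOf _
  have h2 : IsPrimitiveRoot (ψ x : L) (K.relIndex H) := by
    rw [← hord ψ hψ, ← orderOf_units]; exact IsPrimitiveRoot.orderOf _
  obtain ⟨i, hi, hcop, hpow⟩ := (h1.isPrimitiveRoot_iff).1 h2
  refine ⟨ZMod.unitOfCoprime i hcop, eq_of_apply_eq hx hψ.ge
    (ker_pow_units hθ _).ge ?_⟩
  rw [MonoidHom.pow_apply, ZMod.coe_unitOfCoprime, ZMod.val_natCast, Nat.mod_eq_of_lt hi]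
  ext
  simpa using hpow.symm

end Characters

/-- Conjugation by `n ∈ N_G(K)` is a power map on the cyclic group `H / K`. -/
theorem exists_conjExponent (h : IsStrongShodaPair H K) {n : G}
    (hn : n ∈ Subgroup.normalizer (K : Set G)) :
    ∃ t : (ZMod (K.relIndex H))ˣ, ∀ x ∈ H, (x ^ (t : ZMod (K.relIndex H)).val)⁻¹ *
      (n⁻¹ * x * n) ∈ K := by
  -- a character with kernel `K` and its conjugate by `n` differ by a power map
  obtain ⟨θ, hθ⟩ := h.exists_character (Complex.isPrimitiveRoot_exp (K.relIndex H) (NeZero.ne _))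
  have hconj : ∀ x : H, n⁻¹ * x * n ∈ H := fun x => by
    simpa using h.conj_mem (inv_mem hn) x.2
  let ψ : H →* ℂˣ :=
    { toFun x := θ ⟨n⁻¹ * x * n, hconj x⟩
      map_one' := by
        rw [ker_eq_iff.1 hθ]; simp
      map_mul' x y := by
        rw [← map_mul]; congr 1; ext; simp [mul_assoc] }
  have hψ : ψ.ker = K.subgroupOf H := by
    rw [ker_eq_iff]
    intro x
    change θ _ = 1 ↔ _
    rw [ker_eq_iff.1 hθ, Subgroup.mem_normalizer_iff.1 (inv_mem hn) x, inv_inv]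
  obtain ⟨t, ht⟩ := h.exists_eq_pow hθ hψ
  refine ⟨t, fun x hx => ?_⟩
  have := DFunLike.congr_fun ht ⟨x, hx⟩
  exact (apply_eq_apply_iff hθ (x := ⟨x, hx⟩ ^ (t : ZMod (K.relIndex H)).val)
    (y := ⟨n⁻¹ * x * n, hconj ⟨x, hx⟩⟩)).1 (by rw [map_pow]; exact this.symm)

theorem eq_of_forall_pow_mem (h : IsStrongShodaPair H K) {a b : ℕ}
    (hab : ∀ x ∈ H, (x ^ a)⁻¹ * x ^ b ∈ K) : (a : ZMod (K.relIndex H)) = b := by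
  obtain ⟨θ, hθ⟩ := h.exists_character (Complex.isPrimitiveRoot_exp (K.relIndex H) (NeZero.ne _))
  refine (h.pow_eq_pow_iff hθ).1 (MonoidHom.ext fun x => ?_)
  rw [MonoidHom.pow_apply, MonoidHom.pow_apply, ← map_pow, ← map_pow]
  exact (apply_eq_apply_iff hθ).2 (hab x x.2)

theorem eq_of_forall_conj_mem (h : IsStrongShodaPair H K) {n : G} {a b : ℕ}
    (ha : ∀ x ∈ H, (x ^ a)⁻¹ * (n⁻¹ * x * n) ∈ K) (hb : ∀ x ∈ H, (x ^ b)⁻¹ * (n⁻¹ * x * n) ∈ K) :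
    (a : ZMod (K.relIndex H)) = b :=
  h.eq_of_forall_pow_mem fun x hx => by
    have := mul_mem (ha x hx) (inv_mem (hb x hx))
    simpa [mul_assoc] using this

/-- The action of `N_G(K)` on the cyclic group `H / K`, as a homomorphism to `(ℤ/[H : K]ℤ)ˣ`: the
element `n` is sent to `t` when `n⁻¹ x n ∈ x ^ t K` for all `x ∈ H`. -/
def conjExponent (h : IsStrongShodaPair H K) :
    Subgroup.normalizer (K : Set G) →* (ZMod (K.relIndex H))ˣ :=
  MonoidHom.mk' (fun n => (h.exists_conjExponent n.2).choose) fun n m => by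
    have hn := (h.exists_conjExponent n.2).choose_spec
    have hm := (h.exists_conjExponent m.2).choose_spec
    have hnm := (h.exists_conjExponent (n * m).2).choose_spec
    set a := (h.exists_conjExponent n.2).choose
    set b := (h.exists_conjExponent m.2).choose
    ext
    rw [← ZMod.natCast_zmod_val ((h.exists_conjExponent (n * m).2).choose :
        ZMod (K.relIndex H)), Units.val_mul, ← ZMod.natCast_zmod_val (a : ZMod (K.relIndex H)),
      ← ZMod.natCast_zmod_val (b : ZMod (K.relIndex H)), ← Nat.cast_mul]
    refine h.eq_of_forall_conj_mem (n := (n * m : G)) hnm fun x hx => ?_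
    have h1 := (Subgroup.mem_normalizer_iff.1 (inv_mem m.2) _).1 (hn x hx)
    have h2 := hm _ (pow_mem hx (a : ZMod (K.relIndex H)).val)
    have h3 := mul_mem h2 h1
    rw [pow_mul]
    simpa [mul_assoc] using h3

theorem conjExponent_spec (h : IsStrongShodaPair H K) (n : Subgroup.normalizer (K : Set G))
    {x : G} (hx : x ∈ H) :
    (x ^ (h.conjExponent n : ZMod (K.relIndex H)).val)⁻¹ * ((n : G)⁻¹ * x * n) ∈ K :=
  (h.exists_conjExponent n.2).choose_spec x hx

theorem apply_conj (h : IsStrongShodaPair H K) {L : Type*} [Field L] {θ : H →* Lˣ}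
    (hθ : θ.ker = K.subgroupOf H) (n : Subgroup.normalizer (K : Set G)) {x y : H}
    (hy : (y : G) = (n : G)⁻¹ * x * n) :
    θ y = θ x ^ (h.conjExponent n : ZMod (K.relIndex H)).val := by
  rw [← map_pow]
  refine ((apply_eq_apply_iff hθ).2 ?_).symm
  rw [hy]
  exact h.conjExponent_spec n x.2

end IsStrongShodaPair

/-! ### Central characters -/

section CentralCharacters
variable {G : Type*} [Group G] [Fintype G] {F : Type*} [Field F] [CharZero F]
  {L : Type*} [Field L] [Algebra F L] {H K M : Subgroup G}

/-- A character with values in `Lˣ` as a monoid homomorphism to `L`. -/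
abbrev toField (ψ : H →* Lˣ) : H →* L := (Units.coeHom L).comp ψ

theorem charFunctional_hat_of_forall {ψ : H →* Lˣ} (hMH : M ≤ H)
    (hM : ∀ m : H, (m : G) ∈ M → ψ m = 1) :
    charFunctional F (toField ψ) (scalarExt F (hat M)) = 1 := by
  have hc : (Nat.card M : F) ≠ 0 := Nat.cast_ne_zero.2 Nat.card_pos.ne'
  have h1 : ∀ g ∈ Finset.univ.filter (fun g : G => g ∈ M),
      charFunctional F (toField ψ) (.single g 1) = 1 := fun g hg => by
    have hg' := (Finset.mem_filter.1 hg).2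
    rw [charFunctional_single (F := F) (⟨g, hMH hg'⟩ : H)]
    simp [hM ⟨g, hMH hg'⟩ hg']
  rw [scalarExt_hat, map_smul, map_sum, Finset.sum_congr rfl h1, Finset.sum_const,
    ← Fintype.card_subtype, ← Nat.card_eq_fintype_card, ← Nat.cast_smul_eq_nsmul F, smul_smul]
  exact (congrArg (· • (1 : L)) (inv_mul_cancel₀ hc)).trans (one_smul F _)

theorem charFunctional_hat_eq_zero {ψ : H →* Lˣ} {m : H} (hm : (m : G) ∈ M)
    (hψ : ψ m ≠ 1) : charFunctional F (toField ψ) (scalarExt F (hat M)) = 0 := by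
  have h1 : (.single (m : G) 1 : MonoidAlgebra F G) * scalarExt F (hat M) =
      scalarExt F (hat M) := by
    simpa using congrArg (scalarExt F) (single_mul_hat hm)
  have h2 := congrArg (charFunctional F (toField ψ)) h1
  rw [charFunctional_mul_of_left_mem (single_mem_range m.2 1), charFunctional_single] at h2
  by_contra h0
  exact hψ (Units.ext (by simpa using (mul_eq_right₀ h0).1 h2))

/-- A linear character of `H` with kernel `K` is `1` at `ε(H, K)`. -/
theorem charFunctional_eps (hKH : K ≤ H) {ψ : H →* Lˣ} (hψ : ψ.ker = K.subgroupOf H) :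
    charFunctional F (toField ψ) (scalarExt F (eps H K)) = 1 := by
  have hker := IsStrongShodaPair.ker_eq_iff.1 hψ
  refine (scalarExt_eps_induction (F := F) (H := H) (K := K) (p := fun x =>
    x ∈ (inclusionHom F H).range ∧ charFunctional F (toField ψ) x = 1) ?_ ?_ ?_ ?_).2
  · exact ⟨scalarExt_hat_mem_range hKH, charFunctional_hat_of_forall hKH fun m hm => (hker m).2 hm⟩
  · exact ⟨one_mem _, charFunctional_one _⟩
  · rintro x y ⟨hx, hx1⟩ ⟨hy, hy1⟩
    exact ⟨mul_mem hx hy, by rw [charFunctional_mul_of_left_mem hx, hx1, hy1, one_mul]⟩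
  · intro M hM
    obtain ⟨m, hmM, hmK⟩ := Set.exists_of_ssubset hM.prop.1
    have hmH := hM.prop.2.1 hmM
    refine ⟨sub_mem (one_mem _) (scalarExt_hat_mem_range hM.prop.2.1), ?_⟩
    rw [map_sub, charFunctional_one, charFunctional_hat_eq_zero (m := ⟨m, hmH⟩) hmM
      (fun h => hmK ((hker _).1 h)), sub_zero]

namespace IsStrongShodaPair

/-- A linear character of `H` whose kernel strictly contains `K` vanishes at `ε(H, K)`. -/
theorem charFunctional_eps_eq_zero (h : IsStrongShodaPair H K) {ψ : H →* Lˣ}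
    (hψ : K.subgroupOf H ≤ ψ.ker) {c : H} (hc : (c : G) ∉ K) (hψc : ψ c = 1) :
    charFunctional F (toField ψ) (scalarExt F (eps H K)) = 0 := by
  obtain ⟨M, hMA, hM⟩ := h.exists_isMinimalNormalOver c.2 hc (A := ψ.ker.map H.subtype)
    (fun k hk => ⟨⟨k, h.le hk⟩, hψ hk, rfl⟩) ⟨c, hψc, rfl⟩
  obtain ⟨x, hx⟩ := exists_eps_eq_mul hM
  rw [hx, map_mul, map_sub, map_one, charFunctional_mul_of_right_mem
    (sub_mem (one_mem _) (scalarExt_hat_mem_range hM.prop.2.1)), map_sub, charFunctional_one,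
    charFunctional_hat_of_forall hM.prop.2.1, sub_self, mul_zero]
  intro m hm
  obtain ⟨y, hy, hym⟩ := hMA hm
  rwa [← show y = m from Subtype.ext hym]

omit [Fintype G] [CharZero F] in
theorem center_comm (z : Subalgebra.center F (MonoidAlgebra F G)) (x : MonoidAlgebra F G) :
    x * z = z * x := Subalgebra.mem_center_iff.1 z.2 x

/-- The central character attached to a strong Shoda pair `(H, K)` and a linear character `ψ` of `H`
with kernel `K`: it sends `z` to the value of `ψ` at `z ε(H, K) ∈ F[H]`. Over a large field, it is
the central character of the representation induced from `ψ`. -/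
def centralCharacter (h : IsStrongShodaPair H K) (F : Type*) [Field F] [CharZero F] [Algebra F L]
    (ψ : H →* Lˣ) (hψ : ψ.ker = K.subgroupOf H) :
    Subalgebra.center F (MonoidAlgebra F G) →ₐ[F] L :=
  AlgHom.ofLinearMap
    (charFunctional F (toField ψ) ∘ₗ (LinearMap.mulRight F (scalarExt F (eps H K))) ∘ₗ
      (Subalgebra.center F (MonoidAlgebra F G)).val.toLinearMap)
    (by simpa using charFunctional_eps h.le hψ)
    (fun z w => by
      have hεw : scalarExt F (eps H K) * ((w : MonoidAlgebra F G) * scalarExt F (eps H K)) =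
          w * scalarExt F (eps H K) := by
        rw [← mul_assoc, center_comm w, mul_assoc, eps_mul_eps]
      have hw : (z * w : MonoidAlgebra F G) * scalarExt F (eps H K) =
          (z * scalarExt F (eps H K)) * ((w : MonoidAlgebra F G) * scalarExt F (eps H K)) := by
        rw [mul_assoc, mul_assoc, hεw]
      have := charFunctional_mul_of_left_mem (χ := toField ψ)
        (y := (w : MonoidAlgebra F G) * scalarExt F (eps H K))
        (h.center_mul_eps_mem (center_comm z))
      simpa [hw] using this)

theorem centralCharacter_apply (h : IsStrongShodaPair H K) {ψ : H →* Lˣ}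
    (hψ : ψ.ker = K.subgroupOf H) (z : Subalgebra.center F (MonoidAlgebra F G)) :
    h.centralCharacter F ψ hψ z = charFunctional F (toField ψ) (z * scalarExt F (eps H K)) := rfl

/-- Fourier inversion on `H / K`: a central element killed by all the central characters of `(H, K)`
is killed by `ε(H, K)`. -/
theorem mul_eps_eq_zero (h : IsStrongShodaPair H K) {ζ : L}
    (hζ : IsPrimitiveRoot ζ (K.relIndex H)) {z : Subalgebra.center F (MonoidAlgebra F G)}
    (hz : ∀ (ψ : H →* Lˣ) (hψ : ψ.ker = K.subgroupOf H), h.centralCharacter F ψ hψ z = 0) :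
    (z : MonoidAlgebra F G) * scalarExt F (eps H K) = 0 := by
  obtain ⟨θ, hθ⟩ := h.exists_character hζ
  set w := (z : MonoidAlgebra F G) * scalarExt F (eps H K) with hw
  set k := K.relIndex H with hk
  have hwH : w ∈ (inclusionHom F H).range := h.center_mul_eps_mem (center_comm z)
  have hle : ∀ j, K.subgroupOf H ≤ (θ ^ j).ker := fun c y hy => by
    rw [← hθ] at hy
    rw [MonoidHom.mem_ker, MonoidHom.pow_apply, hy, one_pow]
  -- all powers of `θ` vanish at `w`; those with a kernel larger than `K` already do at `ε`
  have hvan : ∀ j, charFunctional F (toField (θ ^ j)) w = 0 := fun j => by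
    by_cases hj : (θ ^ j).ker = K.subgroupOf H
    · exact hz _ hj
    · obtain ⟨c, hc, hcK⟩ := SetLike.exists_of_lt (lt_of_le_of_ne (hle j) (Ne.symm hj))
      rw [hw, charFunctional_mul_of_right_mem (scalarExt_eps_mem_range h.le),
        h.charFunctional_eps_eq_zero (hle j) hcK hc, mul_zero]
  have hsum : ∀ χ : H →* L, charFunctional F χ w = ∑ y : H, algebraMap F L (w.coeff y) * χ y := by
    intro χ
    rw [charFunctional, LinearMap.comp_apply, AlgHom.toLinearMap_apply, MonoidAlgebra.lift_apply,
      Finsupp.sum_fintype _ _ (by simp)]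
    exact Finset.sum_congr rfl fun y _ => by rw [coeff_restriction, Algebra.smul_def]
  -- the coefficients of `w` are constant on the cosets of `K`
  have hwK : ∀ (g k : G), k ∈ K → w.coeff (g * k) = w.coeff g := by
    intro g k hkK
    have h1 : w * .single k⁻¹ 1 = w := by
      rw [hw, mul_assoc, ← (h.commute_single_scalarExt_eps (h.le_normalizer
        (h.le (inv_mem hkK)))).eq, single_mul_scalarExt_eps (inv_mem hkK)]
    conv_rhs => rw [← h1]
    simp
  have hgeom : ∀ u : Lˣ, u ^ k = 1 →
      ∑ j ∈ Finset.range k, (u : L) ^ j = if u = 1 then (k : L) else 0 := by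
    intro u hu
    split_ifs with h1
    · simp [h1]
    · have h2 := mul_geom_sum (u : L) k
      rw [← Units.val_pow_eq_pow_val, hu, Units.val_one, sub_self] at h2
      exact (mul_eq_zero.1 h2).resolve_left fun h3 => h1 (Units.ext (sub_eq_zero.1 h3))
  have : CharZero L := charZero_of_injective_algebraMap (algebraMap F L).injective
  -- `∑ⱼ θ(g)⁻ʲ θʲ(w)` vanishes, and is `k |K|` times the coefficient of `w` at `g`
  have hH : ∀ g : H, w.coeff g = 0 := by
    intro g
    have h1 : ∑ j ∈ Finset.range k,
        ((θ g⁻¹ ^ j : Lˣ) : L) * charFunctional F (toField (θ ^ j)) w = 0 :=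
      Finset.sum_eq_zero fun j _ => by rw [hvan, mul_zero]
    have h2 : ∑ j ∈ Finset.range k, ((θ g⁻¹ ^ j : Lˣ) : L) * charFunctional F (toField (θ ^ j)) w =
        ∑ y : H, if (g : G)⁻¹ * y ∈ K then algebraMap F L (w.coeff g) * k else 0 := by
      simp_rw [hsum, Finset.mul_sum]
      rw [Finset.sum_comm]
      refine Finset.sum_congr rfl fun y _ => ?_
      have h3 : ∀ j, ((θ g⁻¹ ^ j : Lˣ) : L) * (algebraMap F L (w.coeff y) * toField (θ ^ j) y) =
          algebraMap F L (w.coeff y) * ((θ (g⁻¹ * y) : Lˣ) : L) ^ j := fun j => by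
        simp only [MonoidHom.comp_apply, MonoidHom.pow_apply, Units.coeHom_apply, map_mul,
          Units.val_pow_eq_pow_val, Units.val_mul, mul_pow]
        ring
      simp_rw [h3]
      rw [← Finset.mul_sum, hgeom _ (pow_relIndex_eq_one hθ _)]
      have h4 : θ (g⁻¹ * y) = 1 ↔ (g : G)⁻¹ * y ∈ K := ker_eq_iff.1 hθ _
      simp only [h4]
      split_ifs with h5
      · have := hwK g _ h5
        rw [mul_inv_cancel_left] at this
        rw [this]
      · rw [mul_zero]
    rw [h2, ← Finset.sum_filter, Finset.sum_const, smul_eq_zero, Finset.card_eq_zero] at h1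
    rcases h1 with h1 | h1
    · exact absurd (h1 ▸ Finset.mem_filter.2 ⟨Finset.mem_univ g, by simp⟩ :
        g ∈ (∅ : Finset H)) (Finset.notMem_empty _)
    · exact (map_eq_zero (algebraMap F L)).1
        ((mul_eq_zero.1 h1).resolve_right (Nat.cast_ne_zero.2 (NeZero.ne k)))
  ext g
  by_cases hg : g ∈ H
  · exact hH ⟨g, hg⟩
  · exact mem_range_inclusionHom_iff.1 hwH g hg

end IsStrongShodaPair
end CentralCharacters

/-! ### The idempotents `e(G, H, K)` and conjugation of central characters -/

section Idempotents
variable {G : Type*} [Group G] [Fintype G] {H K : Subgroup G}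

omit [Fintype G] in
theorem conj_conj (α : MonoidAlgebra ℚ G) (g g' : G) : conj (conj α g) g' = conj α (g * g') := by
  simp only [conj, mul_assoc, MonoidAlgebra.single_mul_single, mul_one]
  simp only [← mul_assoc, MonoidAlgebra.single_mul_single, mul_one, mul_inv_rev]

omit [Fintype G] in
theorem conj_one (α : MonoidAlgebra ℚ G) : conj α 1 = α := by
  simp [conj, ← MonoidAlgebra.one_def]

omit [Fintype G] in
theorem conj_mul (α β : MonoidAlgebra ℚ G) (g : G) : conj (α * β) g = conj α g * conj β g := by
  have h : (.single g 1 : MonoidAlgebra ℚ G) * .single g⁻¹ 1 = 1 := by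
    simp [MonoidAlgebra.single_mul_single, ← MonoidAlgebra.one_def]
  calc conj (α * β) g = .single g⁻¹ 1 * α * 1 * β * .single g 1 := by
        rw [conj, mul_one, mul_assoc _ α β]
    _ = conj α g * conj β g := by rw [← h, conj, conj]; simp only [mul_assoc]

theorem conj_idem (H K : Subgroup G) (g : G) : conj (idem H K) g = idem H K := by
  have h1 : conj (idem H K) g =
      ∑ α ∈ Finset.univ.image (fun x : G => conj (eps H K) x), conj α g := by
    simp only [conj, idem, Finset.mul_sum, Finset.sum_mul]
  rw [h1, idem]
  refine Finset.sum_nbij' (fun α => conj α g) (fun α => conj α g⁻¹) ?_ ?_ ?_ ?_ ?_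
  · rintro α hα
    obtain ⟨x, -, rfl⟩ := Finset.mem_image.1 hα
    rw [conj_conj]
    exact Finset.mem_image_of_mem _ (Finset.mem_univ _)
  · rintro α hα
    obtain ⟨x, -, rfl⟩ := Finset.mem_image.1 hα
    rw [conj_conj]
    exact Finset.mem_image_of_mem _ (Finset.mem_univ _)
  · intro α _; rw [conj_conj, mul_inv_cancel, conj_one]
  · intro α _; rw [conj_conj, inv_mul_cancel, conj_one]
  · intro α _; rfl

theorem commute_single_idem (H K : Subgroup G) (g : G) :
    Commute (.single g 1) (idem H K) := by
  have h : (.single g 1 : MonoidAlgebra ℚ G) * .single g⁻¹ 1 = 1 := by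
    simp [MonoidAlgebra.single_mul_single, ← MonoidAlgebra.one_def]
  have h1 := conj_idem H K g
  rw [conj] at h1
  calc .single g 1 * idem H K = .single g 1 * (.single g⁻¹ 1 * idem H K * .single g 1) := by rw [h1]
    _ = (.single g 1 * .single g⁻¹ 1) * idem H K * .single g 1 := by simp only [mul_assoc]
    _ = _ := by rw [h, one_mul]

theorem IsStrongShodaPair.conj_eps (h : IsStrongShodaPair H K) {n : G}
    (hn : n ∈ Subgroup.normalizer (K : Set G)) : conj (eps H K) n = eps H K := by
  rw [conj, mul_assoc, ← (commute_single_eps (h.normalizer_le hn) hn).eq, ← mul_assoc,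
    MonoidAlgebra.single_mul_single, inv_mul_cancel, one_mul, ← MonoidAlgebra.one_def, one_mul]

theorem IsStrongShodaPair.idem_mul_eps (h : IsStrongShodaPair H K) :
    idem H K * eps H K = eps H K := by
  rw [idem, Finset.sum_mul, Finset.sum_eq_single (eps H K), eps_mul_self]
  · intro α hα hne
    obtain ⟨g, -, rfl⟩ := Finset.mem_image.1 hα
    have hg : g ∉ Subgroup.normalizer (K : Set G) := fun hg => hne (h.conj_eps hg)
    have := h.eps_mul_single_mul_eps (F := ℚ) hg
    rw [scalarExt_rat] at this
    rw [conj, mul_assoc, mul_assoc, ← mul_assoc (eps H K), this, mul_zero]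
  · intro h1
    exact absurd (Finset.mem_image.2 ⟨1, Finset.mem_univ _, conj_one _⟩) h1

theorem IsStrongShodaPair.idem_mul_self (h : IsStrongShodaPair H K) :
    idem H K * idem H K = idem H K := by
  conv_lhs => rw [idem.eq_def H K]
  rw [← idem, idem.eq_def, Finset.mul_sum]
  refine Finset.sum_congr rfl fun α hα => ?_
  obtain ⟨g, -, rfl⟩ := Finset.mem_image.1 hα
  rw [← idem, ← conj_idem H K g, ← conj_mul, h.idem_mul_eps]

variable (F : Type*) [Field F] [CharZero F]

theorem scalarExt_idem_mem_center (H K : Subgroup G) :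
    scalarExt F (idem H K) ∈ Subalgebra.center F (MonoidAlgebra F G) := by
  refine Subalgebra.mem_center_iff.2 fun x => ?_
  induction x using MonoidAlgebra.induction_linear with
  | zero => simp
  | add x y hx hy => rw [add_mul, mul_add, hx, hy]
  | single g r =>
    have h1 : (.single g r : MonoidAlgebra F G) = r • .single g 1 := by simp
    have h2 := (commute_single_idem H K g).map (scalarExt F)
    rw [scalarExt_single, map_one] at h2
    rw [h1, smul_mul_assoc, mul_smul_comm, h2.eq]

/-- The idempotent `e(G, H, K)` as an element of the centre of `F[G]`. -/
def centralIdem (H K : Subgroup G) : Subalgebra.center F (MonoidAlgebra F G) :=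
  ⟨scalarExt F (idem H K), scalarExt_idem_mem_center F H K⟩

variable {F}

theorem IsStrongShodaPair.centralIdem_mul_self (h : IsStrongShodaPair H K) :
    centralIdem F H K * centralIdem F H K = centralIdem F H K :=
  Subtype.ext (by
    change scalarExt F (idem H K) * scalarExt F (idem H K) = scalarExt F (idem H K)
    rw [← map_mul, h.idem_mul_self])

theorem mul_centralIdem_eq_zero {z : Subalgebra.center F (MonoidAlgebra F G)}
    (hz : (z : MonoidAlgebra F G) * scalarExt F (eps H K) = 0) : z * centralIdem F H K = 0 := by
  refine Subtype.ext ?_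
  change (z : MonoidAlgebra F G) * scalarExt F (idem H K) = 0
  rw [idem, map_sum, Finset.mul_sum]
  refine Finset.sum_eq_zero fun α hα => ?_
  obtain ⟨g, -, rfl⟩ := Finset.mem_image.1 hα
  rw [conj, map_mul, map_mul, mul_assoc, ← mul_assoc (z : MonoidAlgebra F G),
    ← IsStrongShodaPair.center_comm z, mul_assoc, ← mul_assoc (z : MonoidAlgebra F G), hz, zero_mul,
    mul_zero]

namespace IsStrongShodaPair
variable {L : Type*} [Field L] [Algebra F L]

theorem centralCharacter_centralIdem (h : IsStrongShodaPair H K) {ψ : H →* Lˣ}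
    (hψ : ψ.ker = K.subgroupOf H) : h.centralCharacter F ψ hψ (centralIdem F H K) = 1 := by
  rw [centralCharacter_apply, ← charFunctional_eps (F := F) h.le hψ, centralIdem, ← map_mul,
    h.idem_mul_eps]

/-- Characters of `H` conjugate under `N_G(K)` have the same central character. -/
theorem centralCharacter_pow_conjExponent (h : IsStrongShodaPair H K) {ψ ψ' : H →* Lˣ}
    (hψ : ψ.ker = K.subgroupOf H) (hψ' : ψ'.ker = K.subgroupOf H)
    (n : Subgroup.normalizer (K : Set G))
    (hn : ψ' = ψ ^ (h.conjExponent n : ZMod (K.relIndex H)).val) :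
    h.centralCharacter F ψ' hψ' = h.centralCharacter F ψ hψ := by
  ext z
  rw [centralCharacter_apply, centralCharacter_apply]
  -- `ψ'` is `ψ` composed with conjugation by `n`, which fixes `z ε`
  have key : ∀ x : MonoidAlgebra F H, charFunctional F (toField ψ') (inclusionHom F H x) =
      charFunctional F (toField ψ)
        (.single (n : G)⁻¹ 1 * inclusionHom F H x * .single (n : G) 1) := by
    intro x
    induction x using MonoidAlgebra.induction_linear with
    | zero => simp
    | add x y hx hy => rw [map_add, map_add, hx, hy, mul_add, add_mul, map_add]
    | single y r =>
      have hyn : (n : G)⁻¹ * y * n ∈ H := by simpa using h.conj_mem (inv_mem n.2) y.2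
      have h1 : (.single y r : MonoidAlgebra F H) = r • .single y 1 := by simp
      rw [h1, map_smul, map_smul, mul_smul_comm, smul_mul_assoc, map_smul, inclusionHom_single,
        charFunctional_single, MonoidAlgebra.single_mul_single, MonoidAlgebra.single_mul_single,
        one_mul, one_mul, charFunctional_single (F := F) (⟨_, hyn⟩ : H)]
      simp only [MonoidHom.comp_apply, Units.coeHom_apply]
      rw [h.apply_conj hψ n (x := y) (y := ⟨_, hyn⟩) rfl, hn, MonoidHom.pow_apply]
  obtain ⟨x, hx⟩ := h.center_mul_eps_mem (center_comm z)
  have hx' : inclusionHom F H x = (z : MonoidAlgebra F G) * scalarExt F (eps H K) := hx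
  rw [← hx', key, hx', ← mul_assoc, center_comm z, mul_assoc, mul_assoc,
    ← (h.commute_single_scalarExt_eps n.2).eq, ← mul_assoc (MonoidAlgebra.single (n : G)⁻¹ (1 : F)),
    MonoidAlgebra.single_mul_single, inv_mul_cancel, one_mul, ← MonoidAlgebra.one_def, one_mul]

/-- Galois-conjugate characters of `H` have Galois-conjugate central characters. -/
theorem centralCharacter_map (h : IsStrongShodaPair H K) {ψ ψ' : H →* Lˣ}
    (hψ : ψ.ker = K.subgroupOf H) (hψ' : ψ'.ker = K.subgroupOf H) (σ : L →ₐ[F] L)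
    (hσ : ∀ y, (ψ' y : L) = σ (ψ y)) (z : Subalgebra.center F (MonoidAlgebra F G)) :
    h.centralCharacter F ψ' hψ' z = σ (h.centralCharacter F ψ hψ z) := by
  rw [centralCharacter_apply, centralCharacter_apply]
  generalize (z : MonoidAlgebra F G) * scalarExt F (eps H K) = x
  induction x using MonoidAlgebra.induction_linear with
  | zero => simp
  | add x y hx hy => rw [map_add, map_add, map_add, hx, hy]
  | single g r =>
    by_cases hg : g ∈ H
    · simp [charFunctional, restriction_single_mem F hg, hσ]
    · simp [charFunctional, restriction_single_notMem F hg]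

/-- For `x ∈ H`, the value of the central character of `ψ` at the sum of the conjugates of
`x ε(H, K)` is the sum of the values at `x` of the conjugates of `ψ` under `N_G(K)`: the conjugates
of `x ε(H, K)` by the other elements of `G` are killed by `ε(H, K)`. -/
theorem exists_centralCharacter_eq_sum (h : IsStrongShodaPair H K) (x : H) :
    ∃ z : Subalgebra.center F (MonoidAlgebra F G), ∀ (ψ : H →* Lˣ) (hψ : ψ.ker = K.subgroupOf H),
      h.centralCharacter F ψ hψ z = ∑ n : Subgroup.normalizer (K : Set G),
        (ψ x : L) ^ (h.conjExponent n : ZMod (K.relIndex H)).val := by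
  set ε := scalarExt F (eps H K) with hε
  let z : MonoidAlgebra F G := ∑ g : G, .single g⁻¹ 1 * (.single (x : G) 1 * ε) * .single g 1
  have hz : z ∈ Subalgebra.center F (MonoidAlgebra F G) := by
    have hcomm : ∀ g, .single g 1 * z = z * .single g 1 := by
      intro g
      rw [Finset.mul_sum, Finset.sum_mul]
      refine Fintype.sum_equiv (Equiv.mulRight g⁻¹) _ _ fun g' => ?_
      simp only [Equiv.coe_mulRight, mul_inv_rev, inv_inv]
      rw [mul_assoc _ (MonoidAlgebra.single (g' * g⁻¹) (1 : F)), MonoidAlgebra.single_mul_single,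
        ← mul_assoc (MonoidAlgebra.single g (1 : F)), ← mul_assoc (MonoidAlgebra.single g (1 : F)),
        MonoidAlgebra.single_mul_single]
      simp
    refine Subalgebra.mem_center_iff.2 fun y => ?_
    induction y using MonoidAlgebra.induction_linear with
    | zero => simp
    | add x y hx hy => rw [add_mul, mul_add, hx, hy]
    | single g r =>
      have h1 : (.single g r : MonoidAlgebra F G) = r • .single g 1 := by simp
      rw [h1, smul_mul_assoc, mul_smul_comm, hcomm]
  refine ⟨⟨z, hz⟩, fun ψ hψ => ?_⟩
  rw [centralCharacter_apply]
  change charFunctional F (toField ψ) (z * ε) = _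
  rw [Finset.sum_mul, map_sum, ← Finset.sum_filter_add_sum_filter_not Finset.univ
    (fun g => g ∈ Subgroup.normalizer (K : Set G)), Finset.sum_eq_zero (s := Finset.univ.filter
      fun g => ¬ g ∈ Subgroup.normalizer (K : Set G)), add_zero]
  · rw [Finset.sum_subtype (p := fun g => g ∈ Subgroup.normalizer (K : Set G)) _ (by simp)]
    refine Finset.sum_congr rfl fun n _ => ?_
    have hxn : (n : G)⁻¹ * x * n ∈ H := by simpa using h.conj_mem (inv_mem n.2) x.2
    have h1 : (.single (n : G)⁻¹ 1 * (.single (x : G) 1 * ε) * .single (n : G) 1) * ε =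
        .single ((n : G)⁻¹ * x * n) 1 * ε := by
      rw [mul_assoc, (h.commute_single_scalarExt_eps n.2).eq, ← mul_assoc, mul_assoc _ _ ε,
        mul_assoc _ ε ε, hε, eps_mul_eps, mul_assoc, mul_assoc,
        ← (h.commute_single_scalarExt_eps n.2).eq, ← mul_assoc, ← mul_assoc,
        MonoidAlgebra.single_mul_single, MonoidAlgebra.single_mul_single, one_mul, one_mul]
    rw [h1, charFunctional_mul_of_left_mem (single_mem_range hxn 1), charFunctional_eps h.le hψ,
      mul_one, charFunctional_single (F := F) (⟨_, hxn⟩ : H)]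
    simp only [MonoidHom.comp_apply, Units.coeHom_apply]
    rw [h.apply_conj hψ n (x := x) (y := ⟨_, hxn⟩) rfl, Units.val_pow_eq_pow_val]
  · intro g hg
    have hg' : g ∉ Subgroup.normalizer (K : Set G) := (Finset.mem_filter.1 hg).2
    have : (.single g⁻¹ 1 * (.single (x : G) 1 * ε) * .single g 1) * ε = 0 := by
      rw [mul_assoc, mul_assoc, mul_assoc, ← mul_assoc ε, h.eps_mul_single_mul_eps hg', mul_zero,
        mul_zero]
    rw [this, map_zero]

/-- Characters of `H` with the same central character are conjugate under `N_G(K)`. -/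
theorem exists_eq_pow_conjExponent (h : IsStrongShodaPair H K) {ψ ψ' : H →* Lˣ}
    (hψ : ψ.ker = K.subgroupOf H) (hψ' : ψ'.ker = K.subgroupOf H)
    (heq : h.centralCharacter F ψ' hψ' = h.centralCharacter F ψ hψ) :
    ∃ n, ψ' = ψ ^ (h.conjExponent n : ZMod (K.relIndex H)).val := by
  have : CharZero L := charZero_of_injective_algebraMap (algebraMap F L).injective
  let f (χ : H →* Lˣ) (n : Subgroup.normalizer (K : Set G)) : H →* L :=
    toField (χ ^ (h.conjExponent n : ZMod (K.relIndex H)).val)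
  -- by linear independence of characters, the two orbits coincide as formal sums of characters
  have hsum : ∑ n, Finsupp.single (f ψ' n) (1 : L) = ∑ n, Finsupp.single (f ψ n) (1 : L) := by
    refine linearIndependent_monoidHom H L ?_
    rw [map_sum, map_sum]
    ext x
    obtain ⟨z, hz⟩ := h.exists_centralCharacter_eq_sum (F := F) (L := L) x
    have := (hz ψ' hψ').symm.trans ((AlgHom.congr_fun heq z).trans (hz ψ hψ))
    simpa [f] using this
  by_contra! hcon
  have h0 : (∑ n, Finsupp.single (f ψ n) (1 : L)) (toField ψ') = 0 := by
    rw [Finsupp.finsetSum_apply]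
    refine Finset.sum_eq_zero fun n _ => Finsupp.single_eq_of_ne fun hne => hcon n ?_
    ext y
    simpa [f] using DFunLike.congr_fun hne y
  rw [← hsum, Finsupp.finsetSum_apply] at h0
  simp_rw [Finsupp.single_apply] at h0
  rw [Finset.sum_boole, Nat.cast_eq_zero, Finset.card_eq_zero] at h0
  refine Finset.notMem_empty (1 : Subgroup.normalizer (K : Set G)) (h0 ▸ Finset.mem_filter.2
    ⟨Finset.mem_univ _, ?_⟩)
  ext y
  have h1 : ((1 : ZMod (K.relIndex H)).val : ZMod (K.relIndex H)) =
      ((1 : ℕ) : ZMod (K.relIndex H)) := by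
    rw [ZMod.natCast_zmod_val, Nat.cast_one]
  have := apply_pow_eq_of_cast_eq hψ' h1 y
  simp only [f, map_one, Units.val_one, MonoidHom.comp_apply, MonoidHom.pow_apply, this, pow_one]

end IsStrongShodaPair
end Idempotents

/-! ### Counting the primes of the centre -/

section Galois
variable {F : Type*} [Field F]

/-- Two homomorphisms to a normal extension with the same kernel differ by an automorphism. -/
theorem exists_algEquiv_of_ker_eq {A L : Type*} [CommRing A] [Algebra F A] [Field L] [Algebra F L]
    [Normal F L] {f g : A →ₐ[F] L} (hfg : RingHom.ker f = RingHom.ker g) :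
    ∃ σ : L ≃ₐ[F] L, ∀ a, g a = σ (f a) := by
  have halg : Algebra.IsAlgebraic F L := inferInstance
  let K₁ : IntermediateField F L := subalgebraEquivIntermediateField f.range
  let K₂ : IntermediateField F L := subalgebraEquivIntermediateField g.range
  let e : K₁ ≃ₐ[F] K₂ := (Ideal.quotientKerEquivRange f).symm.trans
    ((Ideal.quotientEquivAlgOfEq F hfg).trans (Ideal.quotientKerEquivRange g))
  refine ⟨e.liftNormal L, fun a => ?_⟩
  have hfa : f a ∈ K₁ := ⟨a, rfl⟩
  have h1 := e.liftNormal_commutes L ⟨f a, hfa⟩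
  have h2 : (e ⟨f a, hfa⟩ : L) = g a := by
    have h3 : (Ideal.quotientKerEquivRange f).symm ⟨f a, a, rfl⟩ = Ideal.Quotient.mk _ a := by
      rw [AlgEquiv.symm_apply_eq]
      rfl
    change ((Ideal.quotientKerEquivRange g (Ideal.quotientEquivAlgOfEq F hfg
      ((Ideal.quotientKerEquivRange f).symm ⟨f a, a, rfl⟩)) : g.range) : L) = g a
    rw [h3]
    rfl
  exact (h1.trans h2).symm

end Galois

namespace IsStrongShodaPair
variable {G : Type*} [Group G] [Fintype G] {H K : Subgroup G}

theorem pow_mul_val {L : Type*} [Field L] {θ : H →* Lˣ}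
    (hθ : θ.ker = K.subgroupOf H) (a b : (ZMod (K.relIndex H))ˣ) :
    θ ^ ((a * b : (ZMod (K.relIndex H))ˣ) : ZMod (K.relIndex H)).val =
      (θ ^ (a : ZMod (K.relIndex H)).val) ^ (b : ZMod (K.relIndex H)).val := by
  ext1 y
  rw [MonoidHom.pow_apply, MonoidHom.pow_apply, MonoidHom.pow_apply, ← pow_mul]
  exact apply_pow_eq_of_cast_eq hθ (by simp) y

variable (F : Type*) [Field F] [CharZero F]

/-- The subgroup of `(ℤ/[H : K]ℤ)ˣ` generated by the image of `N_G(K)` and by `I_{[H : K]}(F)`. -/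
def exponentSubgroup (h : IsStrongShodaPair H K) : Subgroup (ZMod (K.relIndex H))ˣ :=
  h.conjExponent.range ⊔ galoisImage F (K.relIndex H)

variable {F}

/-- `Gal(F(ζ)/F)` acts on the values of a linear character of `H` with kernel `K` through its
embedding in `(ℤ/[H : K]ℤ)ˣ`. -/
theorem map_apply_eq_pow {θ : H →* (CyclotomicField (K.relIndex H) F)ˣ}
    (hθ : θ.ker = K.subgroupOf H) (σ : Gal(CyclotomicField (K.relIndex H) F/F)) (y : H) :
    σ (θ y) = (θ y : CyclotomicField (K.relIndex H) F) ^
      ((IsCyclotomicExtension.zeta_spec (K.relIndex H) F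
        (CyclotomicField (K.relIndex H) F)).autToPow F σ : ZMod (K.relIndex H)).val := by
  set hζ := IsCyclotomicExtension.zeta_spec (K.relIndex H) F (CyclotomicField (K.relIndex H) F)
  have h1 : (θ y : CyclotomicField (K.relIndex H) F) ^ K.relIndex H = 1 := by
    rw [← Units.val_pow_eq_pow_val, pow_relIndex_eq_one hθ, Units.val_one]
  obtain ⟨i, -, hi⟩ := hζ.eq_pow_of_pow_eq_one h1
  rw [← hi, map_pow, ← hζ.autToPow_spec F σ, ← pow_mul, ← pow_mul, mul_comm]

/-- The central characters of two linear characters of `H` with kernel `K` have the same kernel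
exactly if the linear characters are conjugate under `N_G(K)` and the Galois group. -/
theorem ker_centralCharacter_eq_iff (h : IsStrongShodaPair H K)
    {θ : H →* (CyclotomicField (K.relIndex H) F)ˣ} (hθ : θ.ker = K.subgroupOf H)
    (u v : (ZMod (K.relIndex H))ˣ) :
    RingHom.ker (h.centralCharacter F _ (ker_pow_units hθ u)) =
      RingHom.ker (h.centralCharacter F _ (ker_pow_units hθ v)) ↔
        u⁻¹ * v ∈ h.exponentSubgroup F := by
  have hgal : IsGalois F (CyclotomicField (K.relIndex H) F) :=
    IsCyclotomicExtension.isGalois {K.relIndex H} F _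
  set hζ := IsCyclotomicExtension.zeta_spec (K.relIndex H) F (CyclotomicField (K.relIndex H) F)
  have hσ : ∀ (σ : Gal(CyclotomicField (K.relIndex H) F/F)) (w : (ZMod (K.relIndex H))ˣ) z,
      h.centralCharacter F _ (ker_pow_units hθ (w * hζ.autToPow F σ)) z =
        σ (h.centralCharacter F _ (ker_pow_units hθ w) z) := fun σ w z =>
    h.centralCharacter_map (ker_pow_units hθ w) (ker_pow_units hθ (w * hζ.autToPow F σ))
      σ.toAlgHom (fun y => by
      rw [pow_mul_val hθ, MonoidHom.pow_apply, Units.val_pow_eq_pow_val]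
      exact (map_apply_eq_pow (ker_pow_units hθ w) σ y).symm) z
  rw [exponentSubgroup, Subgroup.mem_sup]
  constructor
  · intro hker
    obtain ⟨σ, hσ'⟩ := exists_algEquiv_of_ker_eq hker
    obtain ⟨n, hn⟩ := h.exists_eq_pow_conjExponent (F := F)
      (ker_pow_units hθ (u * hζ.autToPow F σ)) (ker_pow_units hθ v)
      (AlgHom.ext fun z => (hσ' z).trans (hσ σ u z).symm)
    refine ⟨h.conjExponent n, ⟨n, rfl⟩, hζ.autToPow F σ, ⟨σ, rfl⟩, ?_⟩
    rw [← pow_mul_val hθ, h.pow_eq_pow_iff hθ, ZMod.natCast_zmod_val, ZMod.natCast_zmod_val] at hn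
    rw [Units.ext hn, mul_assoc, inv_mul_cancel_left, mul_comm]
  · rintro ⟨_, ⟨n, rfl⟩, _, ⟨σ, rfl⟩, huv⟩
    have hv : v = u * hζ.autToPow F σ * h.conjExponent n := by
      rw [mul_assoc, mul_comm (hζ.autToPow F σ)]
      exact (mul_inv_cancel_left u v).symm.trans (by rw [← huv])
    have h1 := h.centralCharacter_pow_conjExponent (F := F)
      (ker_pow_units hθ (u * hζ.autToPow F σ)) (ker_pow_units hθ v) n
      (by rw [hv, pow_mul_val hθ])
    ext z
    rw [RingHom.mem_ker, RingHom.mem_ker]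
    rw [show h.centralCharacter F _ (ker_pow_units hθ v) z = _ from AlgHom.congr_fun h1 z, hσ,
      map_eq_zero_iff σ σ.injective]

end IsStrongShodaPair

/-- In a field of characteristic zero, if idempotents have sum `1`, then only one of them is not
zero. -/
theorem eq_zero_of_sum_idempotents_eq_one {L ι : Type*} [Field L] [CharZero L] {s : Finset ι}
    {a : ι → L} (ha : ∀ i, i ∈ s → a i * a i = a i) (hsum : ∑ i ∈ s, a i = 1) {i j : ι} (hi : i ∈ s)
    (hj : j ∈ s) (hij : i ≠ j) (h1 : a i = 1) : a j = 0 := by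
  have h01 : ∀ k ∈ s, a k = if a k = 1 then 1 else 0 := fun k hk => by
    split_ifs with h
    · exact h
    · have : a k * (a k - 1) = 0 := by rw [mul_sub, ha k hk, mul_one, sub_self]
      exact (mul_eq_zero.1 this).resolve_right fun h' => h (sub_eq_zero.1 h')
  rw [Finset.sum_congr rfl h01, Finset.sum_boole, Nat.cast_eq_one, Finset.card_eq_one] at hsum
  obtain ⟨k, hk⟩ := hsum
  have hik : i = k := Finset.mem_singleton.1 (hk ▸ Finset.mem_filter.2 ⟨hi, h1⟩)
  rw [h01 j hj, if_neg]
  intro h'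
  exact hij (hik.trans (Finset.mem_singleton.1 (hk ▸ Finset.mem_filter.2 ⟨hj, h'⟩)).symm)

section Counting
variable {G : Type*} [Group G] [Fintype G] (F : Type*) [Field F] [CharZero F]

/-- The primes of the centre of `F[G]` are the kernels of the central characters attached to the
pairs of a complete set of representatives. -/
theorem numSimpleComponents_eq_sum_index {X : Finset (Subgroup G × Subgroup G)}
    (hX : IsCompleteSetOfRepresentatives X) :
    numSimpleComponents (MonoidAlgebra F G) =
      ∑ p : X, ((hX.isStrongShodaPair p p.2).exponentSubgroup F).index := by
  rw [numSimpleComponents_eq_card_primeSpectrum F]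
  have h (p : X) : IsStrongShodaPair p.1.1 p.1.2 := hX.isStrongShodaPair p p.2
  let k (p : X) : ℕ := p.1.2.relIndex p.1.1
  have hθ' (p : X) := (h p).exists_character
    (IsCyclotomicExtension.zeta_spec (k p) F (CyclotomicField (k p) F))
  choose θ hθ using hθ'
  let Z := Subalgebra.center F (MonoidAlgebra F G)
  let ω (p : X) (u : (ZMod (k p))ˣ) : Z →ₐ[F] CyclotomicField (k p) F :=
    (h p).centralCharacter F _ (IsStrongShodaPair.ker_pow_units (hθ p) u)
  let P (p : X) (u : (ZMod (k p))ˣ) : PrimeSpectrum Z :=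
    ⟨RingHom.ker (ω p u), RingHom.ker_isPrime _⟩
  have hP (p : X) (u v : (ZMod (k p))ˣ) : P p u = P p v ↔ u⁻¹ * v ∈ (h p).exponentSubgroup F :=
    PrimeSpectrum.ext_iff.trans ((h p).ker_centralCharacter_eq_iff (hθ p) u v)
  let e (p : X) : Z := centralIdem F p.1.1 p.1.2
  have hsum : ∑ p, e p = 1 := by
    have := congrArg (scalarExt F) hX.sum_idem
    rw [map_sum, map_one, ← Finset.sum_coe_sort] at this
    exact Subtype.ext (by simpa [e, centralIdem] using this)
  have hone (p : X) (u) : ω p u (e p) = 1 := (h p).centralCharacter_centralIdem _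
  have hzero (p q : X) (hpq : p ≠ q) (u) : ω p u (e q) = 0 :=
    eq_zero_of_sum_idempotents_eq_one (s := Finset.univ) (a := fun q => ω p u (e q))
      (fun q _ => by rw [← map_mul]; exact congrArg _ (h q).centralIdem_mul_self)
      (by rw [← map_sum, hsum, map_one]) (Finset.mem_univ p) (Finset.mem_univ q) hpq (hone p u)
  -- the primes are indexed by the cosets of the subgroups `A I`, one for each pair
  let f : (Σ p : X, (ZMod (k p))ˣ ⧸ (h p).exponentSubgroup F) → PrimeSpectrum Z :=
    fun a => Quotient.liftOn' a.2 (P a.1) fun u v huv =>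
      (hP a.1 u v).2 (QuotientGroup.leftRel_apply.1 huv)
  have hf : Function.Bijective f := by
    constructor
    · rintro ⟨p, a⟩ ⟨q, b⟩
      induction a using Quotient.inductionOn' with | h u =>
      induction b using Quotient.inductionOn' with | h v =>
      intro hab
      have hab' : P p u = P q v := hab
      by_cases hpq : p = q
      · subst hpq
        exact congrArg (Sigma.mk p) (QuotientGroup.eq.2 ((hP p u v).1 hab'))
      · -- `e q` lies in the primes of the pair `p`, but not in those of `q`
        have h1 : e q ∈ (P p u).asIdeal := hzero p q hpq u
        rw [hab'] at h1
        exact absurd ((hone q v).symm.trans h1) one_ne_zero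
    · intro Q
      have : IsArtinianRing Z := IsArtinianRing.of_finite F _
      -- the kernels of the central characters intersect in zero
      have hbot : (Finset.univ.inf fun a : Σ p : X, (ZMod (k p))ˣ => (P a.1 a.2).asIdeal) ≤
          Q.asIdeal := by
        intro z hz
        rw [Submodule.mem_finsetInf] at hz
        have hz0 (p : X) : z * e p = 0 := by
          refine mul_centralIdem_eq_zero ((h p).mul_eps_eq_zero
            (IsCyclotomicExtension.zeta_spec (k p) F (CyclotomicField (k p) F)) fun ψ hψ => ?_)
          obtain ⟨u, rfl⟩ := (h p).exists_eq_pow (hθ p) hψ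
          exact hz ⟨p, u⟩ (Finset.mem_univ _)
        have : z = 0 := by
          rw [← mul_one z, ← hsum, Finset.mul_sum]
          exact Finset.sum_eq_zero fun p _ => hz0 p
        exact this ▸ Q.asIdeal.zero_mem
      obtain ⟨⟨p, u⟩, -, hpu⟩ := (Ideal.IsPrime.inf_le' Q.2).1 hbot
      refine ⟨⟨p, QuotientGroup.mk u⟩, PrimeSpectrum.ext ?_⟩
      have := (P p u).2
      exact (IsArtinianRing.isMaximal_of_isPrime (P p u).asIdeal).eq_of_le Q.2.ne_top hpu
  rw [← Nat.card_eq_of_bijective f hf, Nat.card_sigma]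
  rfl

end Counting

/-! ### The two formulas for the number of classes of characters -/

namespace IsStrongShodaPair
variable {G : Type*} [Group G] [Fintype G] {H K : Subgroup G}
variable (F : Type*) [Field F] [CharZero F]

/-- The action of `N_G(K)` on the linear characters of `H`. It is by the inverse of the exponent, as
`χ ^ g` is `h ↦ χ (g h g⁻¹)`, whereas the exponent describes `h ↦ g⁻¹ h g`. -/
theorem comp_normalizerMonoidHom (h : IsStrongShodaPair H K) {θ : H →* ℂˣ}
    (hθ : θ.ker = K.subgroupOf H) (g : Subgroup.normalizer (K : Set G))
    (u : (ZMod (K.relIndex H))ˣ) :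
    (θ ^ (u : ZMod (K.relIndex H)).val).comp
        (H.normalizerMonoidHom ⟨g, h.normalizer_le g.2⟩).toMonoidHom =
      θ ^ ((u * (h.conjExponent g)⁻¹ : (ZMod (K.relIndex H))ˣ) : ZMod (K.relIndex H)).val := by
  rw [pow_mul_val hθ, ← map_inv]
  ext1 y
  rw [MonoidHom.comp_apply]
  refine h.apply_conj (ker_pow_units hθ u) g⁻¹ ?_
  simp [Subgroup.normalizerMonoidHom]
  rfl

/-- `E_F(G, H/K)` is the preimage of `I_k(F)` in `N_G(K)`. -/
theorem mem_stabE_iff (h : IsStrongShodaPair H K) {g : G} :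
    g ∈ stabE F H K ↔ ∃ hg : g ∈ Subgroup.normalizer (K : Set G),
      h.conjExponent ⟨g, hg⟩ ∈ galoisImage F (K.relIndex H) := by
  constructor
  · rintro ⟨hgH, hg, hC⟩
    refine ⟨hg, ?_⟩
    obtain ⟨θ, hθ⟩ := h.exists_character
      (Complex.isPrimitiveRoot_exp (K.relIndex H) (NeZero.ne _))
    have h1 := hC _ ⟨θ, hθ, rfl⟩
    have h2 : θ ^ ((1 : (ZMod (K.relIndex H))ˣ) : ZMod (K.relIndex H)).val ∈
      {χ | ∃ i ∈ galoisImage F (K.relIndex H), χ = θ ^ (i : ZMod (K.relIndex H)).val} :=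
      ⟨1, one_mem _, rfl⟩
    have h3 := Set.mem_image_of_mem
      (fun χ : H →* ℂˣ => χ.comp (H.normalizerMonoidHom ⟨g, hgH⟩).toMonoidHom) h2
    rw [← conjClass, h1] at h3
    obtain ⟨i, hi, hi'⟩ := h3
    have h4 := (h.comp_normalizerMonoidHom hθ ⟨g, hg⟩ 1).symm.trans hi'
    rw [h.pow_eq_pow_iff hθ, ZMod.natCast_zmod_val, ZMod.natCast_zmod_val, one_mul] at h4
    rw [← Units.ext h4] at hi
    simpa using hi
  · rintro ⟨hg, hI⟩
    refine ⟨h.normalizer_le hg, hg, ?_⟩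
    rintro _ ⟨θ, hθ, rfl⟩
    ext χ
    constructor
    · rintro ⟨_, ⟨i, hi, rfl⟩, rfl⟩
      exact ⟨_, mul_mem hi (inv_mem hI), h.comp_normalizerMonoidHom hθ ⟨g, hg⟩ i⟩
    · rintro ⟨i, hi, rfl⟩
      refine ⟨_, ⟨_, mul_mem hi hI, rfl⟩, ?_⟩
      have := h.comp_normalizerMonoidHom hθ ⟨g, hg⟩ (i * h.conjExponent ⟨g, hg⟩)
      rwa [mul_inv_cancel_right] at this

theorem card_stabE (h : IsStrongShodaPair H K) :
    Nat.card (stabE F H K) =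
      Nat.card ((galoisImage F (K.relIndex H)).comap h.conjExponent) := by
  refine Eq.trans ?_ (Subgroup.card_map_of_injective
    (f := (Subgroup.normalizer (K : Set G)).subtype) (Subgroup.subtype_injective _))
  refine congrArg (fun s : Set G => Nat.card s) (Set.ext fun g => ?_)
  rw [h.mem_stabE_iff F, SetLike.mem_coe]
  simp

/-- With `A` the image of `N_G(K)` in `(ℤ/kℤ)ˣ` and `I = I_k(F)`, the left-hand side is
`[(ℤ/kℤ)ˣ : I] / [A : A ∩ I]`. -/
theorem totient_div_mul_eq_index (h : IsStrongShodaPair H K) :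
    (Nat.totient (K.relIndex H) : ℚ) / (Nat.card (galoisImage F (K.relIndex H)) : ℚ) *
      ((Nat.card (stabE F H K) : ℚ) / (Nat.card (Subgroup.normalizer (K : Set G)) : ℚ)) =
      (h.exponentSubgroup F).index := by
  set I := galoisImage F (K.relIndex H) with hI
  have h1 : Nat.card I * I.index = Nat.totient (K.relIndex H) := by
    rw [Subgroup.card_mul_index, Nat.card_eq_fintype_card, ZMod.card_units_eq_totient]
  have h2 : Nat.card (I.comap h.conjExponent) * I.relIndex h.conjExponent.range =
      Nat.card (Subgroup.normalizer (K : Set G)) := by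
    rw [← Subgroup.index_comap, Subgroup.card_mul_index]
  have h3 : I.relIndex h.conjExponent.range * (h.exponentSubgroup F).index = I.index := by
    rw [exponentSubgroup, ← Subgroup.relIndex_sup_right]
    exact Subgroup.relIndex_mul_index le_sup_right
  have hI0 : (Nat.card I : ℚ) ≠ 0 := Nat.cast_ne_zero.2 Nat.card_pos.ne'
  have hE0 : (Nat.card (I.comap h.conjExponent) : ℚ) ≠ 0 := Nat.cast_ne_zero.2 Nat.card_pos.ne'
  have hN0 : (I.relIndex h.conjExponent.range : ℚ) ≠ 0 := by
    intro h0
    rw [Nat.cast_eq_zero] at h0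
    rw [h0, mul_zero] at h2
    exact Nat.card_pos.ne h2
  rw [h.card_stabE F, ← hI, ← h1, ← h2, ← h3]
  push_cast
  field_simp

section Fields
variable {L : Type*} [Field L] [CharZero L] {ζ : L}

open IntermediateField

theorem natCast_eq_of_pow_eq {M : Type*} [CommMonoid M] {η : M} {k : ℕ} [NeZero k]
    (hη : IsPrimitiveRoot η k) {a b : ℕ} (hab : η ^ a = η ^ b) : (a : ZMod k) = b := by
  obtain ⟨u, rfl⟩ := hη.isUnit (NeZero.ne k)
  have h1 : u ^ a = u ^ b := Units.ext (by simpa using hab)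
  rw [pow_eq_pow_iff_modEq, ← orderOf_units, ← hη.eq_orderOf] at h1
  exact (ZMod.natCast_eq_natCast_iff _ _ _).2 h1

theorem isPrimitiveRoot_gen {k : ℕ} (hζ : IsPrimitiveRoot ζ k) :
    IsPrimitiveRoot (AdjoinSimple.gen ℚ ζ) k :=
  IsPrimitiveRoot.of_map_of_injective (f := algebraMap ℚ⟮ζ⟯ L) (by simpa using hζ)
    (algebraMap ℚ⟮ζ⟯ L).injective

/-- The subgroup of `Gal(ℚ(ζ)/ℚ)` by which `N_G(K)` acts is the image of `N_G(K)` in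
`(ℤ/[H : K]ℤ)ˣ`. -/
theorem actionGroup_eq_comap (h : IsStrongShodaPair H K) (hζ : IsPrimitiveRoot ζ (K.relIndex H)) :
    actionGroup ζ H K = h.conjExponent.range.comap ((isPrimitiveRoot_gen hζ).autToPow ℚ) := by
  have hη := isPrimitiveRoot_gen hζ
  rw [actionGroup, ← Subgroup.closure_eq (h.conjExponent.range.comap _)]
  congr 1
  ext σ
  rw [SetLike.mem_coe, Subgroup.mem_comap]
  constructor
  · rintro ⟨g, hg, i, hi, hσ⟩
    refine ⟨⟨g, hg⟩, Units.ext ?_⟩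
    have h1 := h.eq_of_forall_conj_mem (fun x hx => h.conjExponent_spec ⟨g, hg⟩ hx) hi
    rw [ZMod.natCast_zmod_val] at h1
    rw [h1, ← ZMod.natCast_zmod_val (hη.autToPow ℚ σ : ZMod (K.relIndex H))]
    exact natCast_eq_of_pow_eq hη (by rw [← hσ, hη.autToPow_spec ℚ])
  · rintro ⟨g, hg⟩
    refine ⟨g, g.2, _, fun x hx => h.conjExponent_spec g hx, ?_⟩
    rw [hg, hη.autToPow_spec ℚ]

variable {F} in
/-- In `Gal(ℚ(ζ)/ℚ) ≃ (ℤ/kℤ)ˣ`, the field `ℚ(ζ)^{N_G(K)/H}` corresponds to the image of `N_G(K)` and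
`ℚ(ζ) ∩ F` to the image of `Gal(F(ζ)/F)`; so their intersection corresponds to the join of the two
subgroups. -/
theorem finrank_fixedSubfield_inf [Algebra F L] [IsCyclotomicExtension {K.relIndex H} F L]
    (h : IsStrongShodaPair H K) (hζ : IsPrimitiveRoot ζ (K.relIndex H)) :
    Module.finrank ℚ ↥(fixedSubfield ζ H K ⊓ (algebraMap F L).toRatAlgHom.fieldRange) =
      (h.conjExponent.range ⊔ (hζ.autToPow F).range).index := by
  have hη := isPrimitiveRoot_gen hζ
  have hgalF : IsGalois F L := IsCyclotomicExtension.isGalois {K.relIndex H} F L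
  have hfinF : FiniteDimensional F L :=
    IsCyclotomicExtension.finiteDimensional {K.relIndex H} F L
  have hcyc : IsCyclotomicExtension {K.relIndex H} ℚ ℚ⟮ζ⟯ := by
    change IsCyclotomicExtension {K.relIndex H} ℚ ℚ⟮ζ⟯.toSubalgebra
    rw [adjoin_simple_toSubalgebra_of_isAlgebraic
      (hζ.isIntegral (NeZero.pos _)).tower_top.isAlgebraic]
    exact hζ.adjoin_isCyclotomicExtension ℚ
  have hgal : IsGalois ℚ ℚ⟮ζ⟯ := IsCyclotomicExtension.isGalois {K.relIndex H} ℚ _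
  have hfin : FiniteDimensional ℚ ℚ⟮ζ⟯ :=
    IsCyclotomicExtension.finiteDimensional {K.relIndex H} ℚ _
  -- the cyclotomic character of `ℚ(ζ)` is bijective
  let e := hη.autToPow ℚ
  have he : Function.Bijective e := by
    refine (Nat.bijective_iff_injective_and_card e).2 ⟨hη.autToPow_injective (K := ℚ), ?_⟩
    rw [IsGalois.card_aut_eq_finrank, Nat.card_eq_fintype_card, ZMod.card_units_eq_totient]
    exact IsCyclotomicExtension.finrank _ (Polynomial.cyclotomic.irreducible_rat (NeZero.pos _))
  -- restriction of automorphisms is compatible with the cyclotomic characters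
  let res : Gal(L/F) → Gal(ℚ⟮ζ⟯/ℚ) := fun σ => (σ.restrictScalars ℚ).restrictNormal ℚ⟮ζ⟯
  have hres : ∀ (σ : Gal(L/F)) (x : ℚ⟮ζ⟯), (res σ x : L) = σ x := fun σ x =>
    (σ.restrictScalars ℚ).restrictNormal_commutes ℚ⟮ζ⟯ x
  have heres : ∀ σ : Gal(L/F), e (res σ) = hζ.autToPow F σ := by
    intro σ
    ext
    have h1 : (AdjoinSimple.gen ℚ ζ : L) = ζ := AdjoinSimple.coe_gen ℚ ζ
    have h2 := hη.autToPow_spec ℚ (res σ)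
    have h3 := congrArg (fun x : ℚ⟮ζ⟯ => (x : L)) h2
    simp only [hres, h1, SubmonoidClass.coe_pow, ← hζ.autToPow_spec F σ] at h3
    rw [← ZMod.natCast_zmod_val (e (res σ) : ZMod (K.relIndex H)),
      ← ZMod.natCast_zmod_val (hζ.autToPow F σ : ZMod (K.relIndex H))]
    exact natCast_eq_of_pow_eq hζ h3
  -- by Galois theory for `L / F`, the fixed field of `R` is `ℚ(ζ) ∩ F`
  let R : Subgroup Gal(ℚ⟮ζ⟯/ℚ) := (hζ.autToPow F).range.comap e
  have hR : ∀ τ, τ ∈ R ↔ ∃ σ, res σ = τ := by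
    intro τ
    constructor
    · rintro ⟨σ, hσ⟩
      exact ⟨σ, he.1 ((heres σ).trans hσ)⟩
    · rintro ⟨σ, rfl⟩
      exact ⟨σ, (heres σ).symm⟩
  have hfix : ∀ x : ℚ⟮ζ⟯, x ∈ fixedField R ↔
      (x : L) ∈ (algebraMap F L).toRatAlgHom.fieldRange := by
    intro x
    have h1 : (x : L) ∈ (algebraMap F L).toRatAlgHom.fieldRange ↔
      (x : L) ∈ Set.range (algebraMap F L) := Iff.rfl
    rw [h1, IsGalois.mem_range_algebraMap_iff_fixed, IntermediateField.mem_fixedField_iff]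
    constructor
    · intro hx σ
      rw [← hres, hx _ ((hR _).2 ⟨σ, rfl⟩)]
    · intro hx τ hτ
      obtain ⟨σ, rfl⟩ := (hR τ).1 hτ
      exact Subtype.ext ((hres σ x).trans (hx σ))
  have hinter : fixedSubfield ζ H K ⊓ (algebraMap F L).toRatAlgHom.fieldRange =
      lift (fixedField (actionGroup ζ H K ⊔ R)) := by
    ext x
    rw [IntermediateField.mem_inf, fixedSubfield]
    constructor
    · rintro ⟨hx, hxF⟩
      have hxQ : x ∈ ℚ⟮ζ⟯ := lift_le _ hx
      have hx1 := (mem_lift (⟨x, hxQ⟩ : ℚ⟮ζ⟯)).1 hx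
      have hx2 := (hfix ⟨x, hxQ⟩).2 hxF
      refine (mem_lift (⟨x, hxQ⟩ : ℚ⟮ζ⟯)).2 ?_
      have hle : actionGroup ζ H K ⊔ R ≤ MulAction.stabilizer Gal(ℚ⟮ζ⟯/ℚ) (⟨x, hxQ⟩ : ℚ⟮ζ⟯) :=
        sup_le (fun τ hτ => hx1 ⟨τ, hτ⟩) (fun τ hτ => hx2 ⟨τ, hτ⟩)
      exact fun τ => hle τ.2
    · intro hx
      have hxQ : x ∈ ℚ⟮ζ⟯ := lift_le _ hx
      have hx1 := (mem_lift (⟨x, hxQ⟩ : ℚ⟮ζ⟯)).1 hx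
      exact ⟨(mem_lift (⟨x, hxQ⟩ : ℚ⟮ζ⟯)).2 (fixedField_antitone le_sup_left hx1),
        (hfix ⟨x, hxQ⟩).1 (fixedField_antitone le_sup_right hx1)⟩
  have hmap : (actionGroup ζ H K ⊔ R).map e = h.conjExponent.range ⊔ (hζ.autToPow F).range := by
    rw [h.actionGroup_eq_comap hζ, Subgroup.map_sup, Subgroup.map_comap_eq_self_of_surjective he.2,
      Subgroup.map_comap_eq_self_of_surjective he.2]
  calc _ = Module.finrank ℚ ↥(lift (fixedField (actionGroup ζ H K ⊔ R))) := by rw [hinter]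
    _ = Module.finrank ℚ (fixedField (actionGroup ζ H K ⊔ R)) :=
        (liftAlgEquiv _).toLinearEquiv.finrank_eq.symm
    _ = (actionGroup ζ H K ⊔ R).index := by
        rw [finrank_eq_fixingSubgroup_index, fixingSubgroup_fixedField]
    _ = _ := by rw [← hmap, Subgroup.index_map_of_bijective he]

end Fields

theorem interDegree_eq_index (h : IsStrongShodaPair H K) :
    interDegree F H K = (h.exponentSubgroup F).index :=
  h.finrank_fixedSubfield_inf (IsCyclotomicExtension.zeta_spec (K.relIndex H) F
    (CyclotomicField (K.relIndex H) F))

end IsStrongShodaPair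

end

end StrongShoda

theorem mainTheorem4 {G : Type*} [Group G] [Fintype G] (hG : StrongShoda.IsStronglyMonomial G)
    (F : Type*) [Field F] [NumberField F] (X : Finset (Subgroup G × Subgroup G))
    (hX : StrongShoda.IsCompleteSetOfRepresentatives X) :
    (StrongShoda.numSimpleComponents (MonoidAlgebra F G) : ℚ) =
      ∑ p ∈ X, (Nat.totient (p.2.relIndex p.1) : ℚ) /
          (Nat.card (StrongShoda.galoisImage F (p.2.relIndex p.1)) : ℚ) *
        ((Nat.card (StrongShoda.stabE F p.1 p.2) : ℚ) /
          (Nat.card (Subgroup.normalizer (p.2 : Set G)) : ℚ)) ∧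
    ∑ p ∈ X, (Nat.totient (p.2.relIndex p.1) : ℚ) /
          (Nat.card (StrongShoda.galoisImage F (p.2.relIndex p.1)) : ℚ) *
        ((Nat.card (StrongShoda.stabE F p.1 p.2) : ℚ) /
          (Nat.card (Subgroup.normalizer (p.2 : Set G)) : ℚ)) =
      ∑ p ∈ X, (StrongShoda.interDegree F p.1 p.2 : ℚ) := by
  refine ⟨?_, Finset.sum_congr rfl fun p hp => ?_⟩
  · rw [StrongShoda.numSimpleComponents_eq_sum_index F hX, Nat.cast_sum, ← Finset.sum_coe_sort X]
    exact Finset.sum_congr rfl fun p _ =>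
      ((hX.isStrongShodaPair p p.2).totient_div_mul_eq_index F).symm
  · have h := hX.isStrongShodaPair p hp
    rw [h.totient_div_mul_eq_index F, h.interDegree_eq_index F]
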